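/- Let $n\ge 3$ be an integer and $\rho>0$. A set $\mathcal C\subset\mathbb R^2$ is called an algebraic rotor of a regular $n$-gon with apothem $\rho$ (the radius of its inscribed circle) if $$\mathcal C=\{(p(\theta)\cos\theta-p'(\theta)\sin\theta,\ p(\theta)\sin\theta+p'(\theta)\cos\theta) : \theta\in[-\pi,\pi]\}$$ for some trigonometric polynomial of the form $$p(\theta)=\rho+\sum_{k=0}^{m}\bigl(a_{kn+1}\cos((kn+1)\theta)+b_{kn+1}\sin((kn+1)\theta)+a_{kn-1}\cos((kn-1)\theta)+b_{kn-1}\sin((kn-1)\theta)\bigr)$$ with $m\ge 0$ and real coefficients, such that $p(\theta)+p''(\theta)\ge 0$ for all $\theta\in\mathbb R$. A defining polynomial of $\mathcal C$ is an irreducible $f\in\mathbb R[x,y]$ such that the polynomials in $\mathbb R[x,y]$ vanishing on $\mathcal C$ are exactly the multiples of $f$. Then every algebraic rotor of a regular $n$-gon with apothem $\rho$ that is not a circle has a defining polynomial, and the minimum, over all such non-circular rotors, of the total degree of the defining polynomial exists and equals $2n$. -/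

import Mathlib

/-- The curve `θ ∈ [-π, π] ↦ (p θ cos θ - p' θ sin θ, p θ sin θ + p' θ cos θ)`, as a set of points
of the plane. For convex curves, `p` is the support function. -/
noncomputable def supportCurve (p : ℝ → ℝ) : Set (Fin 2 → ℝ) :=
  (fun θ : ℝ => ![p θ * Real.cos θ - deriv p θ * Real.sin θ,
      p θ * Real.sin θ + deriv p θ * Real.cos θ]) '' Set.Icc (-Real.pi) Real.pi

/-- The trigonometric polynomial with constant term `ρ` and harmonics of order `k n + 1` and
`k n - 1`, for `0 ≤ k ≤ m`. The coefficients are indexed by integers, because `k n - 1 = -1`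
for `k = 0`. -/
noncomputable def rotorPolynomial (n : ℕ) (ρ : ℝ) (m : ℕ) (a b : ℤ → ℝ) (θ : ℝ) : ℝ :=
  ρ + ∑ k ∈ Finset.range (m + 1),
    (a ((k : ℤ) * n + 1) * Real.cos (((k : ℝ) * n + 1) * θ)
      + b ((k : ℤ) * n + 1) * Real.sin (((k : ℝ) * n + 1) * θ)
      + a ((k : ℤ) * n - 1) * Real.cos (((k : ℝ) * n - 1) * θ)
      + b ((k : ℤ) * n - 1) * Real.sin (((k : ℝ) * n - 1) * θ))

/-- `C` is an algebraic rotor of a regular `n`-gon with apothem `ρ`: the curve of a trigonometric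
polynomial `p` with constant term `ρ` and harmonics of order `k n ± 1`, which satisfies the
convexity condition `p + p'' ≥ 0`. -/
def IsAlgebraicRotor (n : ℕ) (ρ : ℝ) (C : Set (Fin 2 → ℝ)) : Prop :=
  ∃ (m : ℕ) (a b : ℤ → ℝ),
    (∀ θ : ℝ, 0 ≤ rotorPolynomial n ρ m a b θ + deriv (deriv (rotorPolynomial n ρ m a b)) θ) ∧
    C = supportCurve (rotorPolynomial n ρ m a b)

/-- `C` is a circle (of positive radius) of the Euclidean plane. -/
def IsPlaneCircle (C : Set (Fin 2 → ℝ)) : Prop :=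
  ∃ (c : Fin 2 → ℝ) (r : ℝ), 0 < r ∧ C = {z | (z 0 - c 0) ^ 2 + (z 1 - c 1) ^ 2 = r ^ 2}

/-- `f` is a defining polynomial of `C`: it is irreducible and the polynomials that vanish on `C`
are exactly the multiples of `f`. -/
def IsDefiningPolynomial (C : Set (Fin 2 → ℝ)) (f : MvPolynomial (Fin 2) ℝ) : Prop :=
  Irreducible f ∧ ∀ g : MvPolynomial (Fin 2) ℝ, (∀ z ∈ C, MvPolynomial.eval z g = 0) ↔ f ∣ g

/-! On the unit circle, with `T` for `exp (iθ)`, the support function becomes a Laurent polynomial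
`P`, and the coordinates of the curve become Laurent polynomials `x`, `y`. If `N ≥ 2` is the top
harmonic of `P`, then `x` and `y` have exponents in `[-L, L]` with `L = N + 1`, and both extreme
coefficients of `y` are nonzero. The equation of the curve has degree exactly `2L`.

Upper bound (`exists_aeval_eq_zero`): multiplication by `x` sends the span `V` of `2L` consecutive
powers of `T` into `V + yV`, so it acts on a basis as `A + yB` with constant matrices. Hence `det (X
- A - B Y)` is a relation of degree at most `2L`.

Lower bound (`le_totalDegree_of_aeval_eq_zero`): the parametrization is birational
(`X_mem_adjoin_curve`), because a point of the curve determines its normal direction through the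
gradient of a relation. So `x` generates `ℂ(T)` over `ℂ(y)`, an extension of degree `2L`, and every
relation has degree at least `2L` in its first variable.

The polynomials vanishing on the curve form a nonzero, nonmaximal prime ideal of a two-dimensional
factorial ring, which is therefore principal. The harmonics of a rotor are congruent to `±1` modulo
`n`; harmonics of order at most `1` give circles, so otherwise `N ≥ n - 1`. Equality holds for `ρ +
(ρ / n²) cos ((n - 1)θ)`, which gives `2n`. -/

open LaurentPolynomial

/-! ### Laurent polynomials: evaluation at units and the Euler derivation -/

namespace LaurentPolynomial

theorem coeff_T_mul {R : Type*} [CommSemiring R] (n k : ℤ) (f : R[T;T⁻¹]) :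
    (T n * f).coeff k = f.coeff (k - n) := by
  rw [T_mul, T]
  have := AddMonoidAlgebra.coeff_mul_single_add f (1 : R) n (k - n)
  rwa [sub_add_cancel, mul_one] at this

/-- The `R`-algebra homomorphism `R[T;T⁻¹] → A` which sends `T` to a unit `x`. -/
noncomputable def aevalUnit (R : Type*) {A : Type*} [CommSemiring R] [CommSemiring A] [Algebra R A]
    (x : Aˣ) : R[T;T⁻¹] →ₐ[R] A :=
  { eval₂ (algebraMap R A) x with commutes' := fun r => eval₂_C _ _ r }

section aevalUnit

variable {R A : Type*} [CommSemiring R] [CommSemiring A] [Algebra R A] (x : Aˣ)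

@[simp]
theorem aevalUnit_T (n : ℤ) : aevalUnit R x (T n) = (x ^ n).val := eval₂_T _ _ n

@[simp]
theorem aevalUnit_C (r : R) : aevalUnit R x (C r) = algebraMap R A r := eval₂_C _ _ r

theorem aevalUnit_toLaurent (p : Polynomial R) :
    aevalUnit R x (Polynomial.toLaurent p) = Polynomial.aeval x.val p := eval₂_toLaurent _ _ p

end aevalUnit

theorem eq_zero_of_forall_aevalUnit {R A : Type*} [CommRing R] [CommRing A] [IsDomain A]
    [Algebra R A] [FaithfulSMul R A] (s : Set Aˣ) (hs : s.Infinite) (f : R[T;T⁻¹])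
    (h : ∀ x ∈ s, aevalUnit R x f = 0) : f = 0 := by
  obtain ⟨n, p, hp⟩ := exists_T_pow f
  have hp0 : p = 0 := by
    classical
    by_contra hne
    have hne' : p.map (algebraMap R A) ≠ 0 :=
      (Polynomial.map_ne_zero_iff (FaithfulSMul.algebraMap_injective R A)).2 hne
    refine (hs.image (Units.val_injective.injOn))
      ((p.map (algebraMap R A)).roots.toFinset.finite_toSet.subset ?_)
    rintro _ ⟨x, hx, rfl⟩
    have h1 : Polynomial.aeval x.val p = 0 := by
      rw [← aevalUnit_toLaurent, hp, map_mul, h x hx, zero_mul]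
    simpa [hne', Polynomial.eval_map_algebraMap] using h1
  rw [hp0, map_zero] at hp
  exact ((isUnit_T (R := R) n).mul_left_eq_zero).1 hp.symm

theorem aevalUnit_injective_of_transcendental {R A : Type*} [CommRing R] [CommRing A]
    [Algebra R A] (x : Aˣ) (hx : Transcendental R x.val) :
    Function.Injective (aevalUnit R x) := by
  rw [injective_iff_map_eq_zero]
  intro f hf
  obtain ⟨n, p, hp⟩ := exists_T_pow f
  have h1 : Polynomial.aeval x.val p = 0 := by
    rw [← aevalUnit_toLaurent, hp, map_mul, hf, zero_mul]
  rw [(transcendental_iff.1 hx) p h1, map_zero] at hp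
  exact ((isUnit_T (R := R) n).mul_left_eq_zero).1 hp.symm

/-- The linear map `T ^ n ↦ n T ^ n`. -/
noncomputable def eulerₗ (R : Type*) [CommRing R] : R[T;T⁻¹] →ₗ[R] R[T;T⁻¹] :=
  (AddMonoidAlgebra.coeffLinearEquiv R).symm.toLinearMap ∘ₗ
    Finsupp.lsum R (fun n : ℤ => (Finsupp.lsingle n).comp (LinearMap.mulLeft R (n : R))) ∘ₗ
    (AddMonoidAlgebra.coeffLinearEquiv R).toLinearMap

theorem eulerₗ_C_mul_T {R : Type*} [CommRing R] (r : R) (n : ℤ) :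
    eulerₗ R (C r * T n) = C (n * r) * T n := by
  rw [← single_eq_C_mul_T, ← single_eq_C_mul_T]
  apply AddMonoidAlgebra.coeff_injective
  change Finsupp.lsum R (fun n : ℤ => (Finsupp.lsingle n).comp (LinearMap.mulLeft R (n : R)))
    (Finsupp.single n r) = Finsupp.single n (n * r)
  simp

theorem coeff_eulerₗ {R : Type*} [CommRing R] (f : R[T;T⁻¹]) (k : ℤ) :
    (eulerₗ R f).coeff k = k * f.coeff k := by
  induction f using LaurentPolynomial.induction_on' with
  | add p q hp hq => simp [hp, hq, mul_add]
  | C_mul_T n a =>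
    rw [eulerₗ_C_mul_T, ← single_eq_C_mul_T, ← single_eq_C_mul_T]
    simp only [AddMonoidAlgebra.coeff_single, Finsupp.single_apply]
    split_ifs with h <;> simp [h]

/-- The Euler derivation `T ^ n ↦ n T ^ n` of the Laurent polynomials. -/
noncomputable def euler (R : Type*) [CommRing R] : Derivation R R[T;T⁻¹] R[T;T⁻¹] :=
  Derivation.mk' (eulerₗ R) (by
    intro a b
    induction a using LaurentPolynomial.induction_on' with
    | add p q hp hq => simp only [add_mul, map_add, hp, hq, smul_eq_mul, mul_add]; ring
    | C_mul_T n r =>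
      induction b using LaurentPolynomial.induction_on' with
      | add p q hp hq => simp only [mul_add, map_add, hp, hq, smul_eq_mul, add_mul]; ring
      | C_mul_T m s =>
        have : C r * T n * (C s * T m) = C (r * s) * T (n + m) := by
          rw [T_add, map_mul]; ring
        rw [this, eulerₗ_C_mul_T, eulerₗ_C_mul_T, eulerₗ_C_mul_T, T_add]
        simp only [smul_eq_mul, map_mul, Int.cast_add, map_add]
        ring)

@[simp]
theorem coeff_euler {R : Type*} [CommRing R] (f : R[T;T⁻¹]) (k : ℤ) :
    (euler R f).coeff k = k * f.coeff k := coeff_eulerₗ f k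

theorem euler_C_mul_T {R : Type*} [CommRing R] (r : R) (n : ℤ) :
    euler R (C r * T n) = C (n * r) * T n := eulerₗ_C_mul_T r n

theorem euler_T {R : Type*} [CommRing R] (n : ℤ) : euler R (T n) = (n : R[T;T⁻¹]) * T n := by
  simpa using euler_C_mul_T (1 : R) n

end LaurentPolynomial

/-! ### Principal primes in factorial domains of dimension two -/

/-- A nonzero prime of a factorial domain contains a prime element `f`. If `(f) ≠ I`, then `⊥ < (f)
< I < m` is a chain too long for the dimension. -/
theorem Ideal.IsPrime.exists_irreducible_span_of_lt {R : Type*} [CommRing R] [IsDomain R]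
    [UniqueFactorizationMonoid R] (hdim : ringKrullDim R ≤ 2) {I m : Ideal R} (hI : I.IsPrime)
    (hm : m.IsPrime) (h0 : I ≠ ⊥) (hlt : I < m) :
    ∃ f : R, Irreducible f ∧ I = Ideal.span {f} := by
  obtain ⟨f, hfI, hf⟩ := hI.exists_mem_prime_of_ne_bot h0
  refine ⟨f, hf.irreducible, ?_⟩
  by_contra hne
  have hlt2 : Ideal.span {f} < I :=
    lt_of_le_of_ne ((Ideal.span_singleton_le_iff_mem I).2 hfI) (Ne.symm hne)
  have hprime : (Ideal.span {f}).IsPrime := (Ideal.span_singleton_prime hf.ne_zero).2 hf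
  have hlt1 : (⊥ : Ideal R) < Ideal.span {f} := by
    rw [bot_lt_iff_ne_bot, ne_eq, Ideal.span_singleton_eq_bot]
    exact hf.ne_zero
  let c : LTSeries (PrimeSpectrum R) :=
    { length := 3
      toFun := ![⟨⊥, Ideal.isPrime_bot⟩, ⟨_, hprime⟩, ⟨I, hI⟩, ⟨m, hm⟩]
      step := by
        intro i
        fin_cases i
        · exact hlt1
        · exact hlt2
        · exact hlt }
  have h3 : ((3 : ℕ) : WithBot ℕ∞) ≤ ringKrullDim R := Order.LTSeries.length_le_krullDim c
  have := h3.trans hdim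
  norm_cast at this

/-! ### Upper bound: a determinantal relation between two Laurent polynomials -/

namespace LaurentPolynomial

section Multiplication

variable {K : Type*} [Field K] {L : ℕ} {x y : K[T;T⁻¹]}

theorem eq_sum_of_support (f : K[T;T⁻¹]) (s : Finset ℤ) (hf : ∀ k, k ∉ s → f.coeff k = 0) :
    f = ∑ k ∈ s, C (f.coeff k) * T k := by
  ext k
  rw [AddMonoidAlgebra.coeff_sum, Finsupp.finsetSum_apply]
  simp only [← single_eq_C_mul_T, AddMonoidAlgebra.coeff_single, Finsupp.single_apply]
  rw [Finset.sum_ite_eq' s k]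
  split_ifs with h
  · rfl
  · exact hf k h

/-- The span of `T ^ k` for `-L < k ≤ L`. -/
noncomputable def window (K : Type*) [Field K] (L : ℕ) : Submodule K K[T;T⁻¹] :=
  Submodule.span K (Set.range fun i : Fin (2 * L) => T ((i : ℤ) - L + 1))

theorem T_mem_window {k : ℤ} (h1 : -L < k) (h2 : k ≤ L) : (T k : K[T;T⁻¹]) ∈ window K L := by
  refine Submodule.subset_span ⟨⟨(k + L - 1).toNat, by omega⟩, ?_⟩
  have : (((k + L - 1).toNat : ℕ) : ℤ) - L + 1 = k := by omega
  exact congrArg T this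

theorem T_mem_of_leading {f : K[T;T⁻¹]} {W : Submodule K K[T;T⁻¹]} {s : Finset ℤ} {j m : ℤ}
    (hs : ∀ k, k ∉ s → f.coeff k = 0) (hj : j ∈ s) (hf : f.coeff j ≠ 0) (hfm : f * T m ∈ W)
    (h : ∀ k ∈ s, k ≠ j → T (k + m) ∈ W) : T (j + m) ∈ W := by
  have h1 : f * T m = f.coeff j • T (j + m) + ∑ k ∈ s.erase j, f.coeff k • T (k + m) := by
    conv_lhs => rw [eq_sum_of_support f s hs, Finset.sum_mul]
    rw [← Finset.add_sum_erase s _ hj]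
    simp only [T_add, smul_eq_C_mul, mul_assoc]
  have h2 : f.coeff j • T (j + m) ∈ W := by
    rw [← sub_eq_of_eq_add h1]
    refine W.sub_mem hfm (W.sum_mem fun k hk => W.smul_mem _ (h k ?_ ?_))
    · exact Finset.mem_of_mem_erase hk
    · exact Finset.ne_of_mem_erase hk
  exact (W.smul_mem_iff hf).1 h2

/-- Multiplication by a Laurent polynomial with extreme exponents `-L` and `L` extends the window
to twice its width. -/
theorem T_mem_window_sup (hLpos : 0 < L)
    (hy : ∀ k : ℤ, k ∉ Finset.Icc (-L : ℤ) L → y.coeff k = 0)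
    (hL : y.coeff L ≠ 0) (hL' : y.coeff (-L) ≠ 0) (n : ℕ) (hn : n ≤ L) :
    (T (L + n : ℤ) : K[T;T⁻¹]) ∈ window K L ⊔ (window K L).map (LinearMap.mulLeft K y) ∧
    (T (1 - L - n : ℤ) : K[T;T⁻¹]) ∈ window K L ⊔ (window K L).map (LinearMap.mulLeft K y) := by
  set W := window K L ⊔ (window K L).map (LinearMap.mulLeft K y) with hW
  have hyW : ∀ m : ℤ, -L < m → m ≤ L → y * T m ∈ W := fun m h1 h2 =>
    Submodule.mem_sup_right ⟨T m, T_mem_window h1 h2, rfl⟩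
  have hV : ∀ m : ℤ, -L < m → m ≤ L → (T m : K[T;T⁻¹]) ∈ W := fun m h1 h2 =>
    Submodule.mem_sup_left (T_mem_window h1 h2)
  induction n using Nat.strong_induction_on with
  | _ n ih =>
  rcases Nat.eq_zero_or_pos n with rfl | hpos
  · exact ⟨hV _ (by omega) (by omega), hV _ (by omega) (by omega)⟩
  -- By induction all exponents strictly between `1 - L - n` and `L + n` are reached. The products
  -- `y * T n` and `y * T (1 - n)` each add one new extreme exponent, with nonzero coefficient.
  have hin : ∀ k : ℤ, 1 - L - n < k → k < L + n → (T k : K[T;T⁻¹]) ∈ W := by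
    intro k h1 h2
    by_cases h3 : k ≤ L
    · by_cases h4 : -L < k
      · exact hV k h4 h3
      · have := (ih (1 - L - k).toNat (by omega) (by omega)).2
        rwa [show (1 - L - ((1 - L - k).toNat : ℕ) : ℤ) = k by omega] at this
    · have := (ih (k - L).toNat (by omega) (by omega)).1
      rwa [show (L + ((k - L).toNat : ℕ) : ℤ) = k by omega] at this
  constructor
  · refine T_mem_of_leading hy (by simp) hL (hyW n (by omega) (by omega)) ?_
    intro k hk hne
    rw [Finset.mem_Icc] at hk
    exact hin _ (by omega) (by omega)
  · have := T_mem_of_leading (W := W) (m := 1 - n) hy (by simp) hL' (hyW _ (by omega) (by omega)) ?_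
    · rwa [show (-L + (1 - n) : ℤ) = 1 - L - n by omega] at this
    intro k hk hne
    rw [Finset.mem_Icc] at hk
    exact hin _ (by omega) (by omega)

/-- The exponents of `x * T m` lie between `1 - 2L` and `2L`, which is the range that
`T_mem_window_sup` reaches at `n = L`. -/
theorem mul_T_mem_window_sup (hLpos : 0 < L)
    (hx : ∀ k : ℤ, k ∉ Finset.Icc (-L : ℤ) L → x.coeff k = 0)
    (hy : ∀ k : ℤ, k ∉ Finset.Icc (-L : ℤ) L → y.coeff k = 0)
    (hL : y.coeff L ≠ 0) (hL' : y.coeff (-L) ≠ 0) {m : ℤ} (h1 : -L < m) (h2 : m ≤ L) :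
    x * T m ∈ window K L ⊔ (window K L).map (LinearMap.mulLeft K y) := by
  rw [eq_sum_of_support x _ hx, Finset.sum_mul]
  refine Submodule.sum_mem _ fun k hk => ?_
  rw [mul_assoc, ← T_add, ← smul_eq_C_mul]
  refine Submodule.smul_mem _ _ ?_
  rw [Finset.mem_Icc] at hk
  by_cases h3 : 0 < k + m
  · by_cases h4 : k + m ≤ L
    · exact Submodule.mem_sup_left (T_mem_window (by omega) h4)
    · have := (T_mem_window_sup hLpos hy hL hL' (k + m - L).toNat (by omega)).1
      rwa [show (L + ((k + m - L).toNat : ℕ) : ℤ) = k + m by omega] at this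
  · by_cases h4 : -L < k + m
    · exact Submodule.mem_sup_left (T_mem_window h4 (by omega))
    · have := (T_mem_window_sup hLpos hy hL hL' (1 - L - (k + m)).toNat (by omega)).2
      rwa [show (1 - L - ((1 - L - (k + m)).toNat : ℕ) : ℤ) = k + m by omega] at this

/-- Two Laurent polynomials with exponents between `-L` and `L` satisfy a polynomial relation of
degree at most `2 * L`. -/
theorem exists_aeval_eq_zero (hLpos : 0 < L)
    (hx : ∀ k : ℤ, k ∉ Finset.Icc (-L : ℤ) L → x.coeff k = 0)
    (hy : ∀ k : ℤ, k ∉ Finset.Icc (-L : ℤ) L → y.coeff k = 0)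
    (hL : y.coeff L ≠ 0) (hL' : y.coeff (-L) ≠ 0) :
    ∃ g : MvPolynomial (Fin 2) K, g ≠ 0 ∧ g.totalDegree ≤ 2 * L ∧
      MvPolynomial.aeval ![x, y] g = 0 := by
  let e : Fin (2 * L) → K[T;T⁻¹] := fun i => T ((i : ℤ) - L + 1)
  have key : ∀ i, ∃ A B : Fin (2 * L) → K, x * e i = ∑ j, A j • e j + y * ∑ j, B j • e j := by
    intro i
    obtain ⟨v, hv, _, ⟨w, hw, rfl⟩, hvw⟩ := Submodule.mem_sup.1
      (mul_T_mem_window_sup hLpos hx hy hL hL' (m := (i : ℤ) - L + 1) (by omega) (by omega))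
    obtain ⟨A, rfl⟩ := (Submodule.mem_span_range_iff_exists_fun K).1 hv
    obtain ⟨B, rfl⟩ := (Submodule.mem_span_range_iff_exists_fun K).1 hw
    exact ⟨A, B, hvw.symm⟩
  choose A B hAB using key
  -- `M = X - A - B Y` has entries of degree at most one, so its determinant has degree at most
  -- `2L`.
  obtain ⟨M, hMij⟩ : ∃ M : Matrix (Fin (2 * L)) (Fin (2 * L)) (MvPolynomial (Fin 2) K),
      ∀ i j, M i j = (if i = j then MvPolynomial.X 0 else 0) - MvPolynomial.C (A i j)
        - MvPolynomial.C (B i j) * MvPolynomial.X 1 := ⟨Matrix.of _, fun _ _ => rfl⟩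
  have hM : ∀ i j, (M i j).totalDegree ≤ 1 := by
    intro i j
    rw [hMij]
    refine (MvPolynomial.totalDegree_sub _ _).trans (max_le ((MvPolynomial.totalDegree_sub _ _).trans
      (max_le ?_ ?_)) ?_)
    · split_ifs <;> simp
    · simp
    · refine (MvPolynomial.totalDegree_mul _ _).trans ?_
      simp
  refine ⟨M.det, ?_, ?_, ?_⟩
  · intro h0
    -- At `Y = 0` the determinant becomes the characteristic polynomial of `A`, which is monic.
    let φ : MvPolynomial (Fin 2) K →ₐ[K] Polynomial K := MvPolynomial.aeval ![Polynomial.X, 0]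
    have h1 : φ.mapMatrix M = (Matrix.of A).charmatrix := by
      ext i j : 1
      simp only [AlgHom.mapMatrix_apply, Matrix.map_apply, Matrix.charmatrix_apply,
        Matrix.diagonal_apply, Matrix.of_apply, hMij]
      split_ifs <;> simp [φ, Polynomial.algebraMap_eq]
    have h2 : (Matrix.of A).charpoly = 0 := by
      rw [Matrix.charpoly, ← h1, ← AlgHom.map_det, h0, map_zero]
    exact (Matrix.charpoly_monic _).ne_zero h2
  · rw [Matrix.det_apply]
    refine MvPolynomial.totalDegree_finsetSum_le fun σ _ => ?_
    refine (MvPolynomial.totalDegree_smul_le _ _).trans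
      ((MvPolynomial.totalDegree_finsetProd _ _).trans ?_)
    refine (Finset.sum_le_sum fun i _ => hM _ _).trans ?_
    simp
  · rw [AlgHom.map_det, ← Matrix.exists_mulVec_eq_zero_iff]
    -- Evaluated at `(x, y)`, the matrix kills the nonzero vector `e` of powers of `T`.
    refine ⟨e, ?_, ?_⟩
    · intro h
      exact (isUnit_T _).ne_zero (congrFun h ⟨0, by omega⟩)
    · ext1 i
      simp only [Matrix.mulVec, dotProduct, AlgHom.mapMatrix_apply, Matrix.map_apply,
        Pi.zero_apply, hMij]
      have h1 := hAB i
      simp only [Finset.mul_sum, smul_eq_C_mul] at h1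
      simp only [map_sub, map_mul, MvPolynomial.aeval_C, MvPolynomial.aeval_X, sub_mul,
        Finset.sum_sub_distrib, Matrix.cons_val_one, apply_ite (MvPolynomial.aeval ![x, y]),
        map_zero, ite_mul, zero_mul, Finset.sum_ite_eq, Finset.mem_univ, if_true,
        Matrix.cons_val_zero, ← C_eq_algebraMap]
      rw [h1, add_sub_cancel_left, sub_eq_zero]
      exact Finset.sum_congr rfl fun j _ => by ring

end Multiplication

end LaurentPolynomial

/-! ### Lower bound: degrees of extensions inside the rational functions -/

namespace LaurentPolynomial

section Field

variable {K : Type*} [Field K]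

/-- The inclusion of the Laurent polynomials into the rational functions. -/
noncomputable def toRatFunc (K : Type*) [Field K] : K[T;T⁻¹] →ₐ[K] RatFunc K :=
  aevalUnit K (Units.mk0 RatFunc.X RatFunc.X_ne_zero)

theorem toRatFunc_injective : Function.Injective (toRatFunc K) :=
  aevalUnit_injective_of_transcendental _ RatFunc.transcendental_X

@[simp]
theorem toRatFunc_T (n : ℤ) : toRatFunc K (T n) = RatFunc.X ^ n := by
  simp [toRatFunc]

theorem toRatFunc_toLaurent (p : Polynomial K) :
    toRatFunc K (Polynomial.toLaurent p) = algebraMap _ _ p := by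
  rw [toRatFunc, aevalUnit_toLaurent]
  simp

/-- Write `y = q / T ^ L` with `q` of degree `2L`. The fraction is reduced because the constant
coefficient of `q` is `y.coeff (-L) ≠ 0`. -/
theorem max_natDegree_toRatFunc {L : ℕ} {y : K[T;T⁻¹]}
    (hy : ∀ k : ℤ, k ∉ Finset.Icc (-L : ℤ) L → y.coeff k = 0)
    (hL : y.coeff L ≠ 0) (hL' : y.coeff (-L) ≠ 0) :
    max (toRatFunc K y).num.natDegree (toRatFunc K y).denom.natDegree = 2 * L := by
  let q : Polynomial K := ∑ i ∈ Finset.range (2 * L + 1), Polynomial.monomial i (y.coeff (i - L))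
  have hq : ∀ i, q.coeff i = if i < 2 * L + 1 then y.coeff (i - L) else 0 := by
    intro i
    simp only [q, Polynomial.finsetSum_coeff, Polynomial.coeff_monomial, Finset.sum_ite_eq',
      Finset.mem_range]
  have hqy : Polynomial.toLaurent q = y * T L := by
    have : y = ∑ i ∈ Finset.range (2 * L + 1), C (y.coeff (i - L)) * T ((i : ℤ) - L) := by
      conv_lhs => rw [eq_sum_of_support y _ hy]
      refine Finset.sum_nbij' (fun k => (k + L).toNat) (fun i => (i : ℤ) - L) ?_ ?_ ?_ ?_ ?_
      · intro a ha; simp only [Finset.mem_Icc, Finset.mem_range] at *; omega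
      · intro a ha; simp only [Finset.mem_Icc, Finset.mem_range] at *; omega
      · intro a ha; simp only [Finset.mem_Icc] at *; omega
      · intro a ha; simp only [Finset.mem_range] at *; omega
      · intro a ha
        simp only [Finset.mem_Icc] at ha
        rw [show (((a + L).toNat : ℕ) : ℤ) - L = a by omega]
    conv_rhs => rw [this]
    simp only [q, map_sum, Finset.sum_mul, mul_assoc, ← T_add, sub_add_cancel]
    refine Finset.sum_congr rfl fun i _ => ?_
    rw [← Polynomial.C_mul_X_pow_eq_monomial, Polynomial.toLaurent_C_mul_X_pow]
  have hq2 : q.natDegree = 2 * L := by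
    refine Polynomial.natDegree_eq_of_le_of_coeff_ne_zero ?_ ?_
    · rw [Polynomial.natDegree_le_iff_coeff_eq_zero]
      intro i hi
      rw [hq, if_neg (by omega)]
    · rw [hq, if_pos (by omega)]
      convert hL using 2
      push_cast; ring
  have hq0 : q.coeff 0 ≠ 0 := by
    rw [hq, if_pos (by omega)]
    simpa using hL'
  have hcop : IsCoprime q (Polynomial.X ^ L) := by
    refine IsCoprime.pow_right ?_
    rw [isCoprime_comm]
    refine (Polynomial.irreducible_X.coprime_iff_not_dvd).2 ?_
    rwa [Polynomial.X_dvd_iff]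
  set r := toRatFunc K y with hr
  have hr1 : r * algebraMap _ _ (Polynomial.X ^ L : Polynomial K) = algebraMap _ _ q := by
    rw [← toRatFunc_toLaurent q, hqy, map_mul, toRatFunc_T, map_pow, RatFunc.algebraMap_X,
      zpow_natCast]
  have hr2 : r.num * Polynomial.X ^ L = q * r.denom := by
    apply RatFunc.algebraMap_injective K
    rw [map_mul, map_mul, ← hr1]
    have h3 := RatFunc.num_div_denom r
    have h4 : algebraMap (Polynomial K) (RatFunc K) r.denom ≠ 0 :=
      RatFunc.algebraMap_ne_zero r.denom_ne_zero
    rw [div_eq_iff h4] at h3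
    rw [h3]
    ring
  have h5 : r.num ∣ q := by
    refine (r.isCoprime_num_denom).dvd_of_dvd_mul_right ?_
    exact ⟨_, hr2.symm⟩
  have h6 : q ∣ r.num := hcop.dvd_of_dvd_mul_right ⟨_, hr2⟩
  have hqne : q ≠ 0 := by rintro h; simp [h] at hq0
  have h7 : r.num.natDegree = 2 * L := by
    rw [← hq2]
    exact Polynomial.natDegree_eq_of_degree_eq
      (Polynomial.degree_eq_degree_of_associated (associated_of_dvd_dvd h5 h6))
  have h8 : r.num ≠ 0 := fun h => hqne (by rwa [h, zero_dvd_iff] at h5)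
  have h9 := congrArg Polynomial.natDegree hr2
  rw [Polynomial.natDegree_mul h8 (by simp), Polynomial.natDegree_mul hqne r.denom_ne_zero, h7,
    hq2, Polynomial.natDegree_X_pow] at h9
  omega

open IntermediateField in
-- Since `x` generates `K(T)` over `K(y)`, its minimal polynomial there has degree `[K(T) : K(y)] =
-- 2L`. It divides `g`, read as a polynomial in the first variable over `K(y)`.
theorem le_totalDegree_of_aeval_eq_zero {L : ℕ} {x y : K[T;T⁻¹]} (hLpos : 0 < L)
    (hy : ∀ k : ℤ, k ∉ Finset.Icc (-L : ℤ) L → y.coeff k = 0)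
    (hL : y.coeff L ≠ 0) (hL' : y.coeff (-L) ≠ 0)
    (hgen : RatFunc.X ∈ adjoin K {toRatFunc K x, toRatFunc K y})
    {g : MvPolynomial (Fin 2) K} (hg : g ≠ 0) (hg0 : MvPolynomial.aeval ![x, y] g = 0) :
    2 * L ≤ g.totalDegree := by
  set X := toRatFunc K x with hX
  set Y := toRatFunc K y with hY
  have hmax := max_natDegree_toRatFunc hy hL hL'
  have htr : Transcendental K Y := by
    refine RatFunc.transcendental_of_ne_C _ ?_
    rintro ⟨c, hc⟩
    rw [← hY, hc] at hmax
    simp at hmax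
    omega
  let E := K⟮Y⟯
  let Y' : E := ⟨Y, mem_adjoin_simple_self K Y⟩
  have hfin : Module.finrank E (RatFunc K) = 2 * L := by
    rw [RatFunc.finrank_eq_max_natDegree, hmax]
  have htr' : Transcendental K Y' := by
    intro h
    exact htr (h.algebraMap (A := RatFunc K))
  let φ : MvPolynomial (Fin 1) K →ₐ[K] E := MvPolynomial.aeval fun _ => Y'
  -- Transcendence of `y` ensures that `g` stays nonzero over `K(y)`.
  have hφ : Function.Injective φ :=
    algebraicIndependent_unique_type_iff.2 htr'
  let G : Polynomial E := (MvPolynomial.finSuccEquiv K 1 g).map φ.toRingHom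
  have hG : G ≠ 0 := by
    refine (Polynomial.map_ne_zero_iff hφ).2 ?_
    simpa using hg
  have hGdeg : G.natDegree ≤ g.totalDegree := by
    refine (Polynomial.natDegree_map_le).trans ?_
    rw [MvPolynomial.natDegree_finSuccEquiv]
    exact MvPolynomial.degreeOf_le_totalDegree _ _
  have hGX : Polynomial.aeval X G = 0 := by
    let ψ : MvPolynomial (Fin 2) K →ₐ[K] RatFunc K :=
      ((Polynomial.aeval X : Polynomial E →ₐ[E] RatFunc K).restrictScalars K).comp
        ((Polynomial.mapAlgHom φ).comp (MvPolynomial.finSuccEquiv K 1).toAlgHom)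
    have hψ : ψ = (toRatFunc K).comp (MvPolynomial.aeval ![x, y]) := by
      refine MvPolynomial.algHom_ext fun i => ?_
      fin_cases i
      · simp [ψ, MvPolynomial.finSuccEquiv_X_zero, X]
      · have : MvPolynomial.finSuccEquiv K 1 (MvPolynomial.X 1) =
            Polynomial.C (MvPolynomial.X 0) := MvPolynomial.finSuccEquiv_X_succ (j := 0)
        simp [ψ, this, φ, Y']
        rfl
    have h1 : ψ g = 0 := by rw [hψ, AlgHom.comp_apply, hg0, map_zero]
    exact h1
  have hint : IsIntegral E X := (show IsAlgebraic E X from ⟨G, hG, hGX⟩).isIntegral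
  have htop : E⟮X⟯ = ⊤ := by
    have h1 : adjoin K {X, Y} ≤ E⟮X⟯.restrictScalars K := by
      rw [adjoin_le_iff]
      rintro z (rfl | rfl)
      · exact mem_adjoin_simple_self E _
      · exact E⟮X⟯.algebraMap_mem Y'
    have h2 : adjoin K {(RatFunc.X : RatFunc K)} ≤ E⟮X⟯.restrictScalars K :=
      adjoin_simple_le_iff.2 (h1 hgen)
    rw [RatFunc.adjoin_X] at h2
    rw [eq_top_iff]
    intro z _
    exact h2 mem_top
  rw [← hfin, ← finrank_top', ← htop, adjoin.finrank hint]
  exact (Polynomial.natDegree_le_of_dvd (minpoly.dvd _ _ hGX) hG).trans hGdeg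

/-- Split `z` into its even part and `T * w` with `w` even. Even Laurent polynomials lie in `F`,
hence so do `T * w` and `w ≠ 0`, and `T` is their quotient. -/
theorem X_mem_of_odd_coeff {F : IntermediateField K (RatFunc K)}
    (h2 : (RatFunc.X ^ 2 : RatFunc K) ∈ F) {z : K[T;T⁻¹]} (hz : toRatFunc K z ∈ F) {j : ℤ}
    (hj : Odd j) (hzj : z.coeff j ≠ 0) : (RatFunc.X : RatFunc K) ∈ F := by
  classical
  have heven : ∀ k : ℤ, Even k → (RatFunc.X ^ k : RatFunc K) ∈ F := by
    rintro k ⟨m, rfl⟩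
    have : (RatFunc.X ^ (m + m) : RatFunc K) = (RatFunc.X ^ 2) ^ m := by
      rw [← two_mul, zpow_mul]; norm_cast
    rw [this]
    exact zpow_mem h2 m
  set s := z.coeff.support with hs
  let w : K[T;T⁻¹] := ∑ k ∈ s with Odd k, C (z.coeff k) * T (k - 1)
  have hz1 : z = ∑ k ∈ s with ¬ Odd k, C (z.coeff k) * T k + T 1 * w := by
    conv_lhs => rw [eq_sum_of_support z s (by simp [hs])]
    rw [← Finset.sum_filter_not_add_sum_filter s (fun k => Odd k)]
    congr 1
    rw [Finset.mul_sum]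
    refine Finset.sum_congr rfl fun k _ => ?_
    rw [mul_left_comm, ← T_add, add_sub_cancel]
  have hterm : ∀ (a : K) (k : ℤ), Even k → toRatFunc K (C a * T k) ∈ F := by
    intro a k hk
    rw [map_mul, toRatFunc_T, C_eq_algebraMap, AlgHom.commutes]
    exact mul_mem (F.algebraMap_mem a) (heven k hk)
  have hw : toRatFunc K w ∈ F := by
    rw [map_sum]
    refine sum_mem fun k hk => hterm _ _ ?_
    exact (Finset.mem_filter.1 hk).2.sub_odd odd_one
  have hw0 : w ≠ 0 := by
    intro h0
    have h1 := congrArg (fun f : K[T;T⁻¹] => f.coeff (j - 1)) h0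
    simp only [w, AddMonoidAlgebra.coeff_sum, Finsupp.finsetSum_apply, ← single_eq_C_mul_T,
      AddMonoidAlgebra.coeff_single, Finsupp.single_apply, sub_left_inj, Finset.sum_ite_eq',
      AddMonoidAlgebra.coeff_zero, Finsupp.zero_apply] at h1
    rw [if_pos (by simp [hs, hj, hzj])] at h1
    exact hzj h1
  have h3 : RatFunc.X * toRatFunc K w ∈ F := by
    have : RatFunc.X * toRatFunc K w = toRatFunc K z -
        toRatFunc K (∑ k ∈ s with ¬ Odd k, C (z.coeff k) * T k) := by
      rw [eq_sub_iff_add_eq, ← zpow_one (RatFunc.X : RatFunc K), ← toRatFunc_T, ← map_mul,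
        ← map_add, add_comm, ← hz1]
    rw [this]
    refine sub_mem hz ?_
    rw [map_sum]
    refine sum_mem fun k hk => hterm _ _ ?_
    exact Int.not_odd_iff_even.1 (Finset.mem_filter.1 hk).2
  have h4 : toRatFunc K w ≠ 0 := by
    rwa [ne_eq, map_eq_zero_iff _ toRatFunc_injective]
  have := div_mem h3 hw
  rwa [mul_div_cancel_right₀ _ h4] at this

end Field

end LaurentPolynomial

/-! ### Partial derivatives and the chain rule -/

namespace MvPolynomial

theorem totalDegree_pderiv_lt {σ R : Type*} [CommSemiring R] {f : MvPolynomial σ R} {i : σ}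
    (h : pderiv i f ≠ 0) : (pderiv i f).totalDegree < f.totalDegree := by
  have key : ∀ m ∈ (pderiv i f).support, m.degree + 1 ≤ f.totalDegree := by
    intro m hm
    rw [mem_support_iff, coeff_pderiv] at hm
    have h1 : m + Finsupp.single i 1 ∈ f.support := by
      rw [mem_support_iff]
      exact left_ne_zero_of_mul hm
    have h2 := le_totalDegree h1
    change (m + Finsupp.single i 1).degree ≤ _ at h2
    simpa using h2
  obtain ⟨m, hm⟩ := support_nonempty.2 h
  have h1 : (pderiv i f).totalDegree ≤ f.totalDegree - 1 :=
    Finset.sup_le fun m hm => Nat.le_sub_one_of_lt (key m hm)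
  have := key m hm
  omega

theorem eq_C_of_pderiv_eq_zero {σ R : Type*} [CommRing R] [IsDomain R] [CharZero R]
    {f : MvPolynomial σ R} (h : ∀ i, pderiv i f = 0) : f = C (f.coeff 0) := by
  classical
  ext m
  rw [coeff_C]
  split_ifs with hm
  · rw [hm]
  · obtain ⟨i, hi⟩ := Finsupp.ne_iff.1 (Ne.symm hm)
    have h1 := congrArg (coeff (m - Finsupp.single i 1)) (h i)
    rw [coeff_pderiv, coeff_zero] at h1
    have h2 : m - Finsupp.single i 1 + Finsupp.single i 1 = m := by
      refine tsub_add_cancel_of_le ?_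
      rw [Finsupp.single_le_iff]
      exact Nat.one_le_iff_ne_zero.2 hi
    rw [h2] at h1
    exact (mul_eq_zero.1 h1).resolve_right (by norm_cast)

theorem derivation_aeval_fin_two {R A : Type*} [CommRing R] [CommRing A] [Algebra R A]
    (D : Derivation R A A) (x y : A) (f : MvPolynomial (Fin 2) R) :
    D (aeval ![x, y] f) = aeval ![x, y] (pderiv 0 f) * D x + aeval ![x, y] (pderiv 1 f) * D y := by
  induction f using MvPolynomial.induction_on with
  | C a => simp
  | add p q hp hq => simp only [map_add, hp, hq]; ring
  | mul_X p i hp =>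
    rw [map_mul, D.leibniz, hp]
    fin_cases i <;> simp <;> ring

end MvPolynomial

/-! ### The complexified curve of a support function and its birationality -/

namespace LaurentPolynomial

/-- The Laurent polynomial which is the cosine on the unit circle. -/
noncomputable def cosL : ℂ[T;T⁻¹] := C (1 / 2) * (T 1 + T (-1))

/-- The Laurent polynomial which is the sine on the unit circle. -/
noncomputable def sinL : ℂ[T;T⁻¹] := C (-Complex.I / 2) * (T 1 - T (-1))

/-- The derivation which is the differentiation by the angle on the unit circle. -/
noncomputable def angleDeriv : Derivation ℂ ℂ[T;T⁻¹] ℂ[T;T⁻¹] := Complex.I • euler ℂ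

theorem coeff_angleDeriv (f : ℂ[T;T⁻¹]) (k : ℤ) :
    (angleDeriv f).coeff k = Complex.I * k * f.coeff k := by
  simp [angleDeriv, mul_assoc]

theorem angleDeriv_C (a : ℂ) : angleDeriv (C a) = 0 := by
  rw [C_eq_algebraMap, Derivation.map_algebraMap]

theorem angleDeriv_T (n : ℤ) : angleDeriv (T n) = C (Complex.I * n) * T n := by
  simp [angleDeriv, euler_T, smul_eq_C_mul, mul_assoc]

theorem angleDeriv_cosL : angleDeriv cosL = -sinL := by
  have h : (C (1 / 2) * C Complex.I : ℂ[T;T⁻¹]) = -C (-Complex.I / 2) := by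
    rw [← map_mul, ← map_neg]; congr 1; ring
  simp only [cosL, sinL, Derivation.leibniz, angleDeriv_C, map_add, angleDeriv_T, smul_eq_mul,
    mul_zero, add_zero, Int.cast_one, mul_one, Int.cast_neg, mul_neg, map_neg, neg_mul]
  linear_combination (T 1 - T (-1)) * h

theorem angleDeriv_sinL : angleDeriv sinL = cosL := by
  have h : (C (-Complex.I / 2) * C Complex.I : ℂ[T;T⁻¹]) = C (1 / 2) := by
    rw [← map_mul]; congr 1; linear_combination (-1 / 2 : ℂ) * Complex.I_mul_I
  simp only [cosL, sinL, Derivation.leibniz, angleDeriv_C, map_sub, angleDeriv_T, smul_eq_mul,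
    mul_zero, add_zero, Int.cast_one, mul_one, Int.cast_neg, mul_neg, map_neg, neg_mul]
  linear_combination (T 1 + T (-1)) * h

theorem coeff_C_mul (a : ℂ) (f : ℂ[T;T⁻¹]) (k : ℤ) : (C a * f).coeff k = a * f.coeff k := by
  rw [← smul_eq_C_mul]; simp

theorem coeff_mul_cosL (f : ℂ[T;T⁻¹]) (k : ℤ) :
    (f * cosL).coeff k = 1 / 2 * (f.coeff (k - 1) + f.coeff (k + 1)) := by
  rw [cosL, mul_left_comm, coeff_C_mul, mul_add, ← T_mul, ← T_mul, AddMonoidAlgebra.coeff_add,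
    Finsupp.add_apply, coeff_T_mul, coeff_T_mul, sub_neg_eq_add]

theorem coeff_mul_sinL (f : ℂ[T;T⁻¹]) (k : ℤ) :
    (f * sinL).coeff k = -Complex.I / 2 * (f.coeff (k - 1) - f.coeff (k + 1)) := by
  rw [sinL, mul_left_comm, coeff_C_mul, mul_sub, ← T_mul, ← T_mul, AddMonoidAlgebra.coeff_sub,
    Finsupp.sub_apply, coeff_T_mul, coeff_T_mul, sub_neg_eq_add]

/-- The first coordinate of the curve with support function `P`. -/
noncomputable def curveX (P : ℂ[T;T⁻¹]) : ℂ[T;T⁻¹] := P * cosL - angleDeriv P * sinL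

/-- The second coordinate of the curve with support function `P`. -/
noncomputable def curveY (P : ℂ[T;T⁻¹]) : ℂ[T;T⁻¹] := P * sinL + angleDeriv P * cosL

variable (P : ℂ[T;T⁻¹])

theorem coeff_curveX (k : ℤ) : (curveX P).coeff k =
    1 / 2 * ((2 - k) * P.coeff (k - 1) + (k + 2) * P.coeff (k + 1)) := by
  simp only [curveX, AddMonoidAlgebra.coeff_sub, Finsupp.sub_apply, coeff_mul_cosL,
    coeff_mul_sinL, coeff_angleDeriv]
  push_cast
  linear_combination ((1 / 2 : ℂ) * ((k - 1) * P.coeff (k - 1) - (k + 1) * P.coeff (k + 1))) *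
    Complex.I_mul_I

theorem coeff_curveY (k : ℤ) : (curveY P).coeff k =
    Complex.I / 2 * ((k - 2) * P.coeff (k - 1) + (k + 2) * P.coeff (k + 1)) := by
  simp only [curveY, AddMonoidAlgebra.coeff_add, Finsupp.add_apply, coeff_mul_cosL,
    coeff_mul_sinL, coeff_angleDeriv]
  push_cast
  ring

/-- The velocity of the curve is `p + p''` times the unit tangent `(-sin θ, cos θ)`. -/
theorem angleDeriv_curveX :
    angleDeriv (curveX P) = -((P + angleDeriv (angleDeriv P)) * sinL) := by
  simp only [curveX, map_sub, Derivation.leibniz, smul_eq_mul, angleDeriv_cosL, angleDeriv_sinL]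
  ring

theorem angleDeriv_curveY :
    angleDeriv (curveY P) = (P + angleDeriv (angleDeriv P)) * cosL := by
  simp only [curveY, map_add, Derivation.leibniz, smul_eq_mul, angleDeriv_cosL, angleDeriv_sinL]
  ring

/-- Differentiating `f (x, y) = 0` shows that the gradient of `f` is parallel to `(cos θ, sin θ)`.
The factor `p + p''` cancels because its constant coefficient is that of `P`. -/
theorem angleDeriv_eq {f : MvPolynomial (Fin 2) ℂ} (hP : P.coeff 0 ≠ 0)
    (hf : MvPolynomial.aeval ![curveX P, curveY P] f = 0) :
    MvPolynomial.aeval ![curveX P, curveY P] (MvPolynomial.pderiv 0 f) * sinL =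
      MvPolynomial.aeval ![curveX P, curveY P] (MvPolynomial.pderiv 1 f) * cosL := by
  have h := MvPolynomial.derivation_aeval_fin_two angleDeriv (curveX P) (curveY P) f
  rw [hf, map_zero, angleDeriv_curveX, angleDeriv_curveY] at h
  have h0 : P + angleDeriv (angleDeriv P) ≠ 0 := by
    intro h0
    have := congrArg (fun g : ℂ[T;T⁻¹] => g.coeff 0) h0
    simp [coeff_angleDeriv] at this
    exact hP this
  apply mul_left_cancel₀ h0
  linear_combination h

/-- This is `exp (2iθ) = (iA - B) / (iA + B)` when `tan θ = B / A`. -/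
theorem T_two_mul_of_mul_sinL_eq {A B : ℂ[T;T⁻¹]} (hAB : A * sinL = B * cosL) :
    T 2 * (C Complex.I * A + B) = C Complex.I * A - B := by
  have hT : (T 1 * T (-1) : ℂ[T;T⁻¹]) = 1 := by rw [← T_add]; simp
  have h5 : (C (-Complex.I / 2) : ℂ[T;T⁻¹]) = -C Complex.I * C (1 / 2) := by
    rw [← map_neg, ← map_mul]; congr 1; ring
  have h6 : (C (1 / 2) * C 2 : ℂ[T;T⁻¹]) = 1 := by
    rw [← map_mul]; norm_num
  have h7 : (T 2 : ℂ[T;T⁻¹]) = T 1 * T 1 := by rw [← T_add]; rfl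
  rw [sinL, cosL, h5] at hAB
  rw [h7]
  generalize C Complex.I = i at *
  generalize (C (1 / 2) : ℂ[T;T⁻¹]) = c at *
  generalize (C 2 : ℂ[T;T⁻¹]) = d at *
  linear_combination (-T 1 * d) * hAB -
    (i * A * T 1 * T 1 + B * T 1 * T 1 - i * A * T 1 * T (-1) + B * T 1 * T (-1)) * h6
    + (i * A - B) * hT

theorem eq_zero_of_T_two_mul {A B : ℂ[T;T⁻¹]} (h4 : T 2 * (C Complex.I * A + B) = C Complex.I * A - B)
    (h0 : C Complex.I * A + B = 0) : A = 0 ∧ B = 0 := by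
  rw [h0, mul_zero] at h4
  have hII : (C Complex.I * C Complex.I : ℂ[T;T⁻¹]) = -1 := by
    rw [← map_mul, Complex.I_mul_I, map_neg, map_one]
  have h6 : (2 : ℂ[T;T⁻¹]) ≠ 0 := by
    have : (C (2 : ℂ) : ℂ[T;T⁻¹]) ≠ 0 := by
      rw [C_eq_algebraMap, ne_eq, FaithfulSMul.algebraMap_eq_zero_iff]; norm_num
    rwa [map_ofNat] at this
  have hB0 : B = 0 := by
    refine (mul_eq_zero.1 (show 2 * B = 0 from ?_)).resolve_left h6
    linear_combination h0 + h4
  rw [hB0, add_zero] at h0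
  exact ⟨by linear_combination (-C Complex.I) * h0 + A * hII, hB0⟩

/-- Take a relation `f` of minimal degree. If both partial derivatives vanished on the curve,
minimality would make them zero, so `f` would be a nonzero constant vanishing on the curve. -/
theorem exists_derivative_relation (hP : P.coeff 0 ≠ 0)
    (h : ∃ g : MvPolynomial (Fin 2) ℂ, g ≠ 0 ∧ MvPolynomial.aeval ![curveX P, curveY P] g = 0) :
    ∃ g₀ g₁ : MvPolynomial (Fin 2) ℂ,
      (MvPolynomial.aeval ![curveX P, curveY P] g₀ ≠ 0 ∨
        MvPolynomial.aeval ![curveX P, curveY P] g₁ ≠ 0) ∧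
      MvPolynomial.aeval ![curveX P, curveY P] g₀ * sinL =
        MvPolynomial.aeval ![curveX P, curveY P] g₁ * cosL := by
  classical
  have hp : ∃ d : ℕ, ∃ g : MvPolynomial (Fin 2) ℂ, g ≠ 0 ∧
      MvPolynomial.aeval ![curveX P, curveY P] g = 0 ∧ g.totalDegree = d := by
    obtain ⟨g, h1, h2⟩ := h
    exact ⟨_, g, h1, h2, rfl⟩
  obtain ⟨f, hf, hf0, hfd⟩ := Nat.find_spec hp
  have hmin : ∀ i, MvPolynomial.aeval ![curveX P, curveY P] (MvPolynomial.pderiv i f) = 0 →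
      MvPolynomial.pderiv i f = 0 := by
    intro i hi
    by_contra hne
    have h1 := MvPolynomial.totalDegree_pderiv_lt hne
    rw [hfd] at h1
    exact Nat.find_min hp h1 ⟨_, hne, hi, rfl⟩
  refine ⟨_, _, ?_, angleDeriv_eq P hP hf0⟩
  by_contra! hne
  have h7 := MvPolynomial.eq_C_of_pderiv_eq_zero (f := f) (by
    intro i
    fin_cases i
    · exact hmin 0 hne.1
    · exact hmin 1 hne.2)
  rw [h7, MvPolynomial.aeval_C, FaithfulSMul.algebraMap_eq_zero_iff] at hf0
  rw [h7, hf0, map_zero] at hf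
  exact hf rfl

/-- The normal line at a point is a rational function of the point, which gives `T ^ 2`. An odd
coefficient in the coordinates then separates `T` from `-T`. -/
theorem X_mem_adjoin_curve (hP : P.coeff 0 ≠ 0)
    (h : ∃ g : MvPolynomial (Fin 2) ℂ, g ≠ 0 ∧ MvPolynomial.aeval ![curveX P, curveY P] g = 0) :
    RatFunc.X ∈ IntermediateField.adjoin ℂ
      {toRatFunc ℂ (curveX P), toRatFunc ℂ (curveY P)} := by
  obtain ⟨g₀, g₁, hne, hAB⟩ := exists_derivative_relation P hP h
  set F := IntermediateField.adjoin ℂ {toRatFunc ℂ (curveX P), toRatFunc ℂ (curveY P)} with hF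
  have hX : toRatFunc ℂ (curveX P) ∈ F := IntermediateField.subset_adjoin _ _ (by simp)
  have hY : toRatFunc ℂ (curveY P) ∈ F := IntermediateField.subset_adjoin _ _ (by simp)
  have hI : ∀ a : ℂ, toRatFunc ℂ (C a) ∈ F := by
    intro a
    rw [C_eq_algebraMap, AlgHom.commutes]
    exact F.algebraMap_mem a
  have hmem : ∀ g : MvPolynomial (Fin 2) ℂ,
      toRatFunc ℂ (MvPolynomial.aeval ![curveX P, curveY P] g) ∈ F := by
    intro g
    induction g using MvPolynomial.induction_on with
    | C a => rw [MvPolynomial.aeval_C, ← C_eq_algebraMap]; exact hI a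
    | add p q hp hq => rw [map_add, map_add]; exact add_mem hp hq
    | mul_X p i hp =>
      rw [map_mul, map_mul, MvPolynomial.aeval_X]
      refine mul_mem hp ?_
      fin_cases i
      · exact hX
      · exact hY
  generalize MvPolynomial.aeval ![curveX P, curveY P] g₀ = A,
    MvPolynomial.aeval ![curveX P, curveY P] g₁ = B, hmem g₀ = hA, hmem g₁ = hB at *
  have h4 := T_two_mul_of_mul_sinL_eq hAB
  have hne' : toRatFunc ℂ (C Complex.I * A + B) ≠ 0 := by
    rw [ne_eq, map_eq_zero_iff _ toRatFunc_injective]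
    intro h0
    obtain ⟨h1, h2⟩ := eq_zero_of_T_two_mul h4 h0
    exact hne.elim (fun h => h h1) (fun h => h h2)
  have h2 : (RatFunc.X ^ 2 : RatFunc ℂ) ∈ F := by
    have h5 : RatFunc.X ^ 2 * toRatFunc ℂ (C Complex.I * A + B) =
        toRatFunc ℂ (C Complex.I * A - B) := by
      rw [← h4, map_mul, toRatFunc_T]; rfl
    rw [← eq_div_iff hne'] at h5
    rw [h5, map_add, map_sub, map_mul]
    exact div_mem (sub_mem (mul_mem (hI _) hA) hB) (add_mem (mul_mem (hI _) hA) hB)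
  -- The coefficient of `T` in `x + iy` is `P.coeff 0`: the contributions of `P.coeff 2` cancel.
  refine X_mem_of_odd_coeff h2 (z := curveX P + C Complex.I * curveY P) (j := 1) ?_ odd_one ?_
  · rw [map_add, map_mul]
    exact add_mem hX (mul_mem (hI _) hY)
  · rw [AddMonoidAlgebra.coeff_add, Finsupp.add_apply, coeff_C_mul, coeff_curveX, coeff_curveY]
    convert hP using 1
    push_cast
    linear_combination (1 / 2 * (-P.coeff 0 + 3 * P.coeff 2)) * Complex.I_mul_I

section Degree

variable {P} {N : ℕ}

theorem coeff_curveX_eq_zero (hPN : ∀ k : ℤ, (N : ℤ) < |k| → P.coeff k = 0)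
    (k : ℤ) (hk : k ∉ Finset.Icc (-(N + 1 : ℕ) : ℤ) (N + 1 : ℕ)) :
    (curveX P).coeff k = 0 := by
  rw [Finset.mem_Icc] at hk
  rw [coeff_curveX, hPN _ (by rw [lt_abs]; omega), hPN _ (by rw [lt_abs]; omega)]
  simp

theorem coeff_curveY_eq_zero (hPN : ∀ k : ℤ, (N : ℤ) < |k| → P.coeff k = 0)
    (k : ℤ) (hk : k ∉ Finset.Icc (-(N + 1 : ℕ) : ℤ) (N + 1 : ℕ)) :
    (curveY P).coeff k = 0 := by
  rw [Finset.mem_Icc] at hk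
  rw [coeff_curveY, hPN _ (by rw [lt_abs]; omega), hPN _ (by rw [lt_abs]; omega)]
  simp

/-- Up to a unit, the top coefficient is `(N - 1) * P.coeff N`. The factor vanishes for `N = 1`,
where the harmonic is a mere translation. -/
theorem coeff_curveY_top (hN : 2 ≤ N) (hPN : ∀ k : ℤ, (N : ℤ) < |k| → P.coeff k = 0)
    (hP1 : P.coeff N ≠ 0) : (curveY P).coeff (N + 1 : ℕ) ≠ 0 := by
  rw [coeff_curveY, hPN ((N + 1 : ℕ) + 1) (by rw [lt_abs]; omega)]
  push_cast
  rw [add_sub_cancel_right, mul_zero, add_zero]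
  refine mul_ne_zero (by simp) (mul_ne_zero ?_ hP1)
  rw [sub_ne_zero]
  norm_cast
  omega

theorem coeff_curveY_bot (hN : 2 ≤ N) (hPN : ∀ k : ℤ, (N : ℤ) < |k| → P.coeff k = 0)
    (hP2 : P.coeff (-N) ≠ 0) : (curveY P).coeff (-(N + 1 : ℕ)) ≠ 0 := by
  rw [coeff_curveY, hPN (-(N + 1 : ℕ) - 1) (by rw [lt_abs]; omega)]
  have : (-((N + 1 : ℕ) : ℤ) + 1) = -N := by push_cast; ring
  rw [this, mul_zero, zero_add]
  refine mul_ne_zero (by simp) (mul_ne_zero ?_ hP2)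
  norm_cast
  omega

theorem exists_curve_relation (hN : 2 ≤ N) (hPN : ∀ k : ℤ, (N : ℤ) < |k| → P.coeff k = 0)
    (hP1 : P.coeff N ≠ 0) (hP2 : P.coeff (-N) ≠ 0) :
    ∃ g : MvPolynomial (Fin 2) ℂ, g ≠ 0 ∧
    g.totalDegree ≤ 2 * (N + 1) ∧ MvPolynomial.aeval ![curveX P, curveY P] g = 0 :=
  exists_aeval_eq_zero (Nat.succ_pos N) (coeff_curveX_eq_zero hPN) (coeff_curveY_eq_zero hPN)
    (coeff_curveY_top hN hPN hP1) (coeff_curveY_bot hN hPN hP2)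

theorem le_totalDegree_of_curve_relation (hN : 2 ≤ N)
    (hPN : ∀ k : ℤ, (N : ℤ) < |k| → P.coeff k = 0) (hP1 : P.coeff N ≠ 0) (hP2 : P.coeff (-N) ≠ 0)
    (hP0 : P.coeff 0 ≠ 0) {g : MvPolynomial (Fin 2) ℂ}
    (hg : g ≠ 0) (hg0 : MvPolynomial.aeval ![curveX P, curveY P] g = 0) :
    2 * (N + 1) ≤ g.totalDegree :=
  le_totalDegree_of_aeval_eq_zero (Nat.succ_pos N) (coeff_curveY_eq_zero hPN)
    (coeff_curveY_top hN hPN hP1) (coeff_curveY_bot hN hPN hP2)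
    (X_mem_adjoin_curve P hP0 ⟨g, hg, hg0⟩) hg hg0

end Degree

end LaurentPolynomial

/-! ### Back to the real curve: vanishing, defining polynomials and circles -/

namespace LaurentPolynomial

/-- The evaluation of Laurent polynomials at the point of angle `θ` of the unit circle. -/
noncomputable def evalAngle (θ : ℝ) : ℂ[T;T⁻¹] →ₐ[ℂ] ℂ :=
  aevalUnit ℂ (Units.mk0 (Complex.exp (θ * Complex.I)) (Complex.exp_ne_zero _))

theorem evalAngle_T (θ : ℝ) (n : ℤ) :
    evalAngle θ (T n) = Complex.exp (n * (θ * Complex.I)) := by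
  rw [evalAngle, aevalUnit_T, Complex.exp_int_mul]
  simp

@[simp]
theorem evalAngle_C (θ : ℝ) (a : ℂ) : evalAngle θ (C a) = a := by
  simp [evalAngle]

theorem eq_zero_of_forall_evalAngle {f : ℂ[T;T⁻¹]}
    (h : ∀ θ ∈ Set.Icc (-Real.pi) Real.pi, evalAngle θ f = 0) : f = 0 := by
  refine eq_zero_of_forall_aevalUnit
    ((fun θ : ℝ => Units.mk0 (Complex.exp (θ * Complex.I)) (Complex.exp_ne_zero _)) ''
      Set.Ioc (-Real.pi) Real.pi) ?_ f ?_
  · refine (Set.Ioc_infinite (by linarith [Real.pi_pos])).image ?_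
    intro x hx y hy hxy
    have := congrArg Units.val hxy
    simp only [Units.val_mk0] at this
    have h1 := Complex.exp_inj_of_neg_pi_lt_of_le_pi (x := x * Complex.I) (y := y * Complex.I)
      (by simpa using hx.1) (by simpa using hx.2) (by simpa using hy.1) (by simpa using hy.2) this
    simpa using h1
  · rintro _ ⟨θ, hθ, rfl⟩
    exact h θ (Set.Ioc_subset_Icc_self hθ)

/-- The Laurent polynomial which is `cos (j θ)` on the unit circle. -/
noncomputable def cosMulL (j : ℤ) : ℂ[T;T⁻¹] := C (1 / 2) * (T j + T (-j))

/-- The Laurent polynomial which is `sin (j θ)` on the unit circle. -/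
noncomputable def sinMulL (j : ℤ) : ℂ[T;T⁻¹] := C (-Complex.I / 2) * (T j - T (-j))

theorem evalAngle_cosMulL (θ : ℝ) (j : ℤ) :
    evalAngle θ (cosMulL j) = (Real.cos (j * θ) : ℝ) := by
  rw [cosMulL, map_mul, map_add, evalAngle_T, evalAngle_T, evalAngle_C, Complex.ofReal_cos,
    Complex.cos]
  push_cast
  ring_nf

theorem evalAngle_sinMulL (θ : ℝ) (j : ℤ) :
    evalAngle θ (sinMulL j) = (Real.sin (j * θ) : ℝ) := by
  rw [sinMulL, map_mul, map_sub, evalAngle_T, evalAngle_T, evalAngle_C, Complex.ofReal_sin,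
    Complex.sin]
  push_cast
  ring_nf

theorem evalAngle_cosL (θ : ℝ) : evalAngle θ cosL = (Real.cos θ : ℝ) := by
  simpa [cosMulL, cosL] using evalAngle_cosMulL θ 1

theorem evalAngle_sinL (θ : ℝ) : evalAngle θ sinL = (Real.sin θ : ℝ) := by
  simpa [sinMulL, sinL] using evalAngle_sinMulL θ 1

theorem hasDerivAt_evalAngle (f : ℂ[T;T⁻¹]) (θ : ℝ) :
    HasDerivAt (fun t : ℝ => evalAngle t f) (evalAngle θ (angleDeriv f)) θ := by
  induction f using LaurentPolynomial.induction_on' with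
  | add p q hp hq =>
    simp only [map_add]
    exact hp.add hq
  | C_mul_T n a =>
    have h1 : HasDerivAt (fun t : ℝ => (n : ℂ) * ((t : ℂ) * Complex.I)) (n * (1 * Complex.I)) θ :=
      ((hasDerivAt_id θ).ofReal_comp.mul_const Complex.I).const_mul (n : ℂ)
    have h2 := h1.cexp.const_mul a
    simp only [map_mul, evalAngle_T, evalAngle_C, Derivation.leibniz, angleDeriv_C, angleDeriv_T,
      smul_eq_mul, mul_zero, add_zero]
    refine h2.congr_deriv ?_
    ring

section Support

variable {P : ℂ[T;T⁻¹]} {p : ℝ → ℝ}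

theorem evalAngle_angleDeriv (hp : ∀ θ, evalAngle θ P = p θ) (θ : ℝ) :
    evalAngle θ (angleDeriv P) = deriv p θ := by
  have h := hasDerivAt_evalAngle P θ
  have hre := Complex.reCLM.hasFDerivAt.comp_hasDerivAt θ h
  have him := Complex.imCLM.hasFDerivAt.comp_hasDerivAt θ h
  have e1 : (Complex.reCLM ∘ fun t : ℝ => evalAngle t P) = p := by
    ext t; simp [hp]
  have e2 : (Complex.imCLM ∘ fun t : ℝ => evalAngle t P) = fun _ => 0 := by
    ext t; simp [hp]
  rw [e1] at hre
  rw [e2] at him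
  have h3 := him.unique (hasDerivAt_const θ 0)
  rw [hre.deriv]
  apply Complex.ext
  · simp
  · simpa using h3

theorem evalAngle_curveX (hp : ∀ θ, evalAngle θ P = p θ) (θ : ℝ) :
    evalAngle θ (curveX P) = (p θ * Real.cos θ - deriv p θ * Real.sin θ : ℝ) := by
  rw [curveX, map_sub, map_mul, map_mul, hp, evalAngle_angleDeriv hp, evalAngle_cosL,
    evalAngle_sinL]
  push_cast; rfl

theorem evalAngle_curveY (hp : ∀ θ, evalAngle θ P = p θ) (θ : ℝ) :
    evalAngle θ (curveY P) = (p θ * Real.sin θ + deriv p θ * Real.cos θ : ℝ) := by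
  rw [curveY, map_add, map_mul, map_mul, hp, evalAngle_angleDeriv hp, evalAngle_cosL,
    evalAngle_sinL]
  push_cast; rfl

theorem evalAngle_aeval_curve (hp : ∀ θ, evalAngle θ P = p θ) (θ : ℝ)
    (g : MvPolynomial (Fin 2) ℂ) :
    evalAngle θ (MvPolynomial.aeval ![curveX P, curveY P] g) =
      MvPolynomial.eval (fun i => ((![p θ * Real.cos θ - deriv p θ * Real.sin θ,
        p θ * Real.sin θ + deriv p θ * Real.cos θ] i : ℝ) : ℂ)) g := by
  induction g using MvPolynomial.induction_on with
  | C a => rw [MvPolynomial.aeval_C, ← C_eq_algebraMap]; simp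
  | add p q hp hq => simp only [map_add, hp, hq]
  | mul_X q i hq =>
    rw [map_mul, map_mul, map_mul, hq, MvPolynomial.aeval_X, MvPolynomial.eval_X]
    congr 1
    fin_cases i
    · exact evalAngle_curveX hp θ
    · exact evalAngle_curveY hp θ

theorem forall_supportCurve_iff_aeval (hp : ∀ θ, evalAngle θ P = p θ)
    (g : MvPolynomial (Fin 2) ℂ) :
    (∀ z ∈ supportCurve p, MvPolynomial.eval (fun i => ((z i : ℝ) : ℂ)) g = 0) ↔
      MvPolynomial.aeval ![curveX P, curveY P] g = 0 := by
  constructor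
  · intro h
    refine eq_zero_of_forall_evalAngle fun θ hθ => ?_
    rw [evalAngle_aeval_curve hp]
    exact h _ ⟨θ, hθ, rfl⟩
  · rintro h _ ⟨θ, _, rfl⟩
    rw [← evalAngle_aeval_curve hp, h, map_zero]

theorem eval_map_ofReal (z : Fin 2 → ℝ) (g : MvPolynomial (Fin 2) ℝ) :
    MvPolynomial.eval (fun i => ((z i : ℝ) : ℂ)) (MvPolynomial.map (algebraMap ℝ ℂ) g) =
      (MvPolynomial.eval z g : ℝ) := by
  rw [MvPolynomial.eval_map, MvPolynomial.eval₂_eq', MvPolynomial.eval_eq']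
  push_cast; rfl

theorem forall_supportCurve_iff (hp : ∀ θ, evalAngle θ P = p θ) (g : MvPolynomial (Fin 2) ℝ) :
    (∀ z ∈ supportCurve p, MvPolynomial.eval z g = 0) ↔
      MvPolynomial.aeval ![curveX P, curveY P] (MvPolynomial.map (algebraMap ℝ ℂ) g) = 0 := by
  rw [← forall_supportCurve_iff_aeval hp]
  simp only [eval_map_ofReal, Complex.ofReal_eq_zero]

theorem exists_coeff_eq (φ : ℂ →+ ℝ) (g : MvPolynomial (Fin 2) ℂ) :
    ∃ h : MvPolynomial (Fin 2) ℝ, h.totalDegree ≤ g.totalDegree ∧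
      ∀ m, h.coeff m = φ (g.coeff m) := by
  classical
  refine ⟨∑ m ∈ g.support, MvPolynomial.monomial m (φ (g.coeff m)), ?_, ?_⟩
  · refine MvPolynomial.totalDegree_finsetSum_le fun m hm => ?_
    exact (MvPolynomial.totalDegree_monomial_le _ _).trans (MvPolynomial.le_totalDegree hm)
  · intro m
    simp only [MvPolynomial.coeff_sum, MvPolynomial.coeff_monomial, Finset.sum_ite_eq',
      MvPolynomial.mem_support_iff]
    split_ifs with h
    · rfl
    · rw [not_not] at h
      simp [h]

/-- At real points the real and imaginary parts of `g` vanish separately, and one of them is a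
nonzero polynomial. -/
theorem exists_real_relation (C : Set (Fin 2 → ℝ)) {g : MvPolynomial (Fin 2) ℂ} (hg : g ≠ 0)
    (h : ∀ z ∈ C, MvPolynomial.eval (fun i => ((z i : ℝ) : ℂ)) g = 0) :
    ∃ f : MvPolynomial (Fin 2) ℝ, f ≠ 0 ∧ f.totalDegree ≤ g.totalDegree ∧
      ∀ z ∈ C, MvPolynomial.eval z f = 0 := by
  obtain ⟨a, had, ha⟩ := exists_coeff_eq Complex.reAddGroupHom g
  obtain ⟨b, hbd, hb⟩ := exists_coeff_eq Complex.imAddGroupHom g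
  have hab : g = MvPolynomial.map (algebraMap ℝ ℂ) a +
      MvPolynomial.C Complex.I * MvPolynomial.map (algebraMap ℝ ℂ) b := by
    ext m
    rw [MvPolynomial.coeff_add, MvPolynomial.coeff_C_mul, MvPolynomial.coeff_map,
      MvPolynomial.coeff_map, ha, hb, mul_comm]
    exact (Complex.re_add_im _).symm
  have h0 : ∀ z ∈ C, MvPolynomial.eval z a = 0 ∧ MvPolynomial.eval z b = 0 := by
    intro z hz
    have := h z hz
    rw [hab, map_add, map_mul, eval_map_ofReal, eval_map_ofReal, MvPolynomial.eval_C] at this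
    have h1 := congrArg Complex.re this
    have h2 := congrArg Complex.im this
    simp only [Complex.add_re, Complex.ofReal_re, Complex.mul_re, Complex.I_re, zero_mul,
      Complex.I_im, Complex.ofReal_im, mul_zero, sub_zero, add_zero, Complex.zero_re,
      Complex.add_im, Complex.mul_im, one_mul, zero_add, Complex.zero_im] at h1 h2
    exact ⟨h1, h2⟩
  by_cases hne : a = 0
  · refine ⟨b, ?_, hbd, fun z hz => (h0 z hz).2⟩
    rintro rfl
    rw [hne] at hab
    simp [hg] at hab
  · exact ⟨a, hne, had, fun z hz => (h0 z hz).1⟩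

variable {N : ℕ}

theorem exists_supportCurve_relation (hp : ∀ θ, evalAngle θ P = p θ) (hN : 2 ≤ N)
    (hPN : ∀ k : ℤ, (N : ℤ) < |k| → P.coeff k = 0) (hP1 : P.coeff N ≠ 0)
    (hP2 : P.coeff (-N) ≠ 0) :
    ∃ f : MvPolynomial (Fin 2) ℝ, f ≠ 0 ∧ f.totalDegree ≤ 2 * (N + 1) ∧
      ∀ z ∈ supportCurve p, MvPolynomial.eval z f = 0 := by
  obtain ⟨g, hg, hgd, hg0⟩ := exists_curve_relation hN hPN hP1 hP2
  obtain ⟨f, hf, hfd, hf0⟩ :=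
    exists_real_relation _ hg ((forall_supportCurve_iff_aeval hp g).2 hg0)
  exact ⟨f, hf, hfd.trans hgd, hf0⟩

theorem le_totalDegree_of_supportCurve (hp : ∀ θ, evalAngle θ P = p θ) (hP0 : P.coeff 0 ≠ 0)
    (hN : 2 ≤ N) (hPN : ∀ k : ℤ, (N : ℤ) < |k| → P.coeff k = 0) (hP1 : P.coeff N ≠ 0)
    (hP2 : P.coeff (-N) ≠ 0) {f : MvPolynomial (Fin 2) ℝ} (hf : f ≠ 0)
    (h : ∀ z ∈ supportCurve p, MvPolynomial.eval z f = 0) : 2 * (N + 1) ≤ f.totalDegree := by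
  rw [forall_supportCurve_iff hp] at h
  have hinj := FaithfulSMul.algebraMap_injective ℝ ℂ
  have h1 := le_totalDegree_of_curve_relation hN hPN hP1 hP2 hP0
    (by rwa [ne_eq, map_eq_zero_iff _ (MvPolynomial.map_injective _ hinj)]) h
  exact h1.trans (Finset.sup_mono (MvPolynomial.support_map_subset _ _))

theorem exists_isDefiningPolynomial (hp : ∀ θ, evalAngle θ P = p θ)
    (hN : 2 ≤ N) (hPN : ∀ k : ℤ, (N : ℤ) < |k| → P.coeff k = 0) (hP1 : P.coeff N ≠ 0)
    (hP2 : P.coeff (-N) ≠ 0) : ∃ f, IsDefiningPolynomial (supportCurve p) f := by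
  let Ψ : MvPolynomial (Fin 2) ℝ →+* ℂ[T;T⁻¹] :=
    (MvPolynomial.aeval ![curveX P, curveY P] : MvPolynomial (Fin 2) ℂ →ₐ[ℂ] _).toRingHom.comp
      (MvPolynomial.map (algebraMap ℝ ℂ))
  have hΨ : ∀ g, g ∈ RingHom.ker Ψ ↔ ∀ z ∈ supportCurve p, MvPolynomial.eval z g = 0 := fun g =>
    (forall_supportCurve_iff hp g).symm
  obtain ⟨z, hz⟩ : (supportCurve p).Nonempty :=
    Set.Nonempty.image _ ⟨0, by constructor <;> linarith [Real.pi_pos]⟩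
  have hbot : RingHom.ker Ψ ≠ ⊥ := by
    obtain ⟨f, hf, -, hf0⟩ := exists_supportCurve_relation hp hN hPN hP1 hP2
    intro h
    have := (hΨ f).2 hf0
    rw [h] at this
    exact hf this
  have hlt : RingHom.ker Ψ < RingHom.ker (MvPolynomial.eval z) := by
    refine lt_of_le_of_ne (fun g hg => (hΨ g).1 hg z hz) fun heq => ?_
    -- If the vanishing ideal were the ideal of a single point, `y` would be constant, against its
    -- nonzero coefficient at `N + 1`.
    have h1 : MvPolynomial.X 1 - MvPolynomial.C (z 1) ∈ RingHom.ker (MvPolynomial.eval z) := by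
      simp [RingHom.mem_ker]
    rw [← heq, RingHom.mem_ker] at h1
    have h2 : curveY P - C ((z 1 : ℝ) : ℂ) = 0 := by
      rw [← h1]
      simp [Ψ]
    have h3 := congrArg (fun f : ℂ[T;T⁻¹] => f.coeff (N + 1 : ℕ)) h2
    simp only [AddMonoidAlgebra.coeff_sub, Finsupp.sub_apply, C_apply,
      AddMonoidAlgebra.coeff_zero, Finsupp.zero_apply] at h3
    rw [if_neg (by omega), sub_zero] at h3
    exact coeff_curveY_top hN hPN hP1 h3
  have hdim : ringKrullDim (MvPolynomial (Fin 2) ℝ) ≤ 2 := by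
    rw [MvPolynomial.ringKrullDim_of_isNoetherianRing]
    simp
  obtain ⟨f, hf, hspan⟩ := Ideal.IsPrime.exists_irreducible_span_of_lt hdim
    (RingHom.ker_isPrime Ψ) (RingHom.ker_isPrime (MvPolynomial.eval z)) hbot hlt
  refine ⟨f, hf, fun g => ?_⟩
  rw [← hΨ, hspan, Ideal.mem_span_singleton]

/-- A circle satisfies an equation of degree two, below the bound `2 * (N + 1) ≥ 6`. -/
theorem not_isPlaneCircle_supportCurve (hp : ∀ θ, evalAngle θ P = p θ) (hP0 : P.coeff 0 ≠ 0)
    (hN : 2 ≤ N) (hPN : ∀ k : ℤ, (N : ℤ) < |k| → P.coeff k = 0) (hP1 : P.coeff N ≠ 0)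
    (hP2 : P.coeff (-N) ≠ 0) : ¬ IsPlaneCircle (supportCurve p) := by
  rintro ⟨c, r, hr, hC⟩
  let f : MvPolynomial (Fin 2) ℝ := (MvPolynomial.X 0 - MvPolynomial.C (c 0)) ^ 2 +
    (MvPolynomial.X 1 - MvPolynomial.C (c 1)) ^ 2 - MvPolynomial.C (r ^ 2)
  have hf : f ≠ 0 := by
    intro h
    have := congrArg (MvPolynomial.eval c) h
    simp [f] at this
    exact hr.ne' this
  have hlin : ∀ i : Fin 2, ((MvPolynomial.X i - MvPolynomial.C (c i) :
      MvPolynomial (Fin 2) ℝ) ^ 2).totalDegree ≤ 2 := by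
    intro i
    refine (MvPolynomial.totalDegree_pow _ _).trans ?_
    have : (MvPolynomial.X i - MvPolynomial.C (c i) : MvPolynomial (Fin 2) ℝ).totalDegree ≤ 1 :=
      (MvPolynomial.totalDegree_sub _ _).trans (by simp)
    omega
  have hfd : f.totalDegree ≤ 2 := by
    refine (MvPolynomial.totalDegree_sub _ _).trans (max_le ?_ ((MvPolynomial.totalDegree_C _).trans_le (Nat.zero_le _)))
    exact (MvPolynomial.totalDegree_add _ _).trans (max_le (hlin 0) (hlin 1))
  have := le_totalDegree_of_supportCurve hp hP0 hN hPN hP1 hP2 hf (by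
    intro z hz
    rw [hC] at hz
    simp [f, hz.out])
  omega

/-- A first harmonic in the support function only translates the circle of radius `ρ`; the centre is
`(2 Re P₁, -2 Im P₁)`. -/
theorem isPlaneCircle_supportCurve (hp : ∀ θ, evalAngle θ P = p θ) {ρ : ℝ} (hρ : 0 < ρ)
    (hP0 : P.coeff 0 = ρ) (hPN : ∀ k : ℤ, 1 < |k| → P.coeff k = 0)
    (hconj : P.coeff (-1) = starRingEnd ℂ (P.coeff 1)) : IsPlaneCircle (supportCurve p) := by
  have hX : curveX P = C (ρ : ℂ) * cosL + C ((2 * (P.coeff 1).re : ℝ) : ℂ) := by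
    ext k
    rw [AddMonoidAlgebra.coeff_add, Finsupp.add_apply, coeff_mul_cosL, C_apply, C_apply, C_apply,
      coeff_curveX]
    by_cases hk : 2 < |k|
    · rw [lt_abs] at hk
      rw [hPN _ (by rw [lt_abs]; omega), hPN _ (by rw [lt_abs]; omega)]
      rw [if_neg (by omega), if_neg (by omega), if_neg (by omega)]
      simp
    · rw [not_lt, abs_le] at hk
      obtain ⟨h1, h2⟩ := hk
      have e2 := hPN 2 (by norm_num)
      have e3 := hPN 3 (by norm_num)
      have e2' := hPN (-2) (by norm_num)
      have e3' := hPN (-3) (by norm_num)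
      interval_cases k <;> norm_num [e2, e3, e2', e3', hP0, hconj]
      have := Complex.add_conj (P.coeff 1)
      push_cast at this
      linear_combination this
  have hY : curveY P = C (ρ : ℂ) * sinL + C ((-2 * (P.coeff 1).im : ℝ) : ℂ) := by
    ext k
    rw [AddMonoidAlgebra.coeff_add, Finsupp.add_apply, coeff_mul_sinL, C_apply, C_apply, C_apply,
      coeff_curveY]
    by_cases hk : 2 < |k|
    · rw [lt_abs] at hk
      rw [hPN _ (by rw [lt_abs]; omega), hPN _ (by rw [lt_abs]; omega)]
      rw [if_neg (by omega), if_neg (by omega), if_neg (by omega)]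
      simp
    · rw [not_lt, abs_le] at hk
      obtain ⟨h1, h2⟩ := hk
      have e2 := hPN 2 (by norm_num)
      have e3 := hPN 3 (by norm_num)
      have e2' := hPN (-2) (by norm_num)
      have e3' := hPN (-3) (by norm_num)
      interval_cases k <;> norm_num [e2, e3, e2', e3', hP0, hconj]
      · ring
      · have := Complex.sub_conj (P.coeff 1)
        push_cast at this
        linear_combination Complex.I * this + 2 * (P.coeff 1).im * Complex.I_mul_I
      · ring
  have hx : ∀ θ, p θ * Real.cos θ - deriv p θ * Real.sin θ =
      ρ * Real.cos θ + 2 * (P.coeff 1).re := by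
    intro θ
    have := evalAngle_curveX hp θ
    rw [hX, map_add, map_mul, evalAngle_C, evalAngle_C, evalAngle_cosL] at this
    exact_mod_cast this.symm
  have hy : ∀ θ, p θ * Real.sin θ + deriv p θ * Real.cos θ =
      ρ * Real.sin θ + -2 * (P.coeff 1).im := by
    intro θ
    have := evalAngle_curveY hp θ
    rw [hY, map_add, map_mul, evalAngle_C, evalAngle_C, evalAngle_sinL] at this
    exact_mod_cast this.symm
  refine ⟨![2 * (P.coeff 1).re, -2 * (P.coeff 1).im], ρ, hρ, ?_⟩
  ext z
  simp only [supportCurve, hx, hy, Set.mem_image, Set.mem_ofPred_eq, Matrix.cons_val_zero,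
    Matrix.cons_val_one]
  constructor
  · rintro ⟨θ, -, rfl⟩
    simp only [Matrix.cons_val_zero, Matrix.cons_val_one]
    linear_combination ρ ^ 2 * Real.sin_sq_add_cos_sq θ
  · intro h
    let w : ℂ := ⟨z 0 - 2 * (P.coeff 1).re, z 1 - -2 * (P.coeff 1).im⟩
    have hw : ‖w‖ = ρ := by
      rw [← Real.sqrt_sq hρ.le, ← h, Complex.norm_def, Complex.normSq_apply]
      congr 1
      simp only [w]
      ring
    refine ⟨w.arg, ⟨(Complex.neg_pi_lt_arg w).le, Complex.arg_le_pi w⟩, ?_⟩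
    have h1 := Complex.norm_mul_cos_arg w
    have h2 := Complex.norm_mul_sin_arg w
    rw [hw] at h1 h2
    ext i
    fin_cases i
    · exact (congrArg (· + 2 * (P.coeff 1).re) h1).trans (sub_add_cancel _ _)
    · exact (congrArg (· + -2 * (P.coeff 1).im) h2).trans (sub_add_cancel _ _)

end Support

end LaurentPolynomial

/-! ### Harmonics of rotors and the extremal example -/

namespace LaurentPolynomial

theorem coeff_T (j k : ℤ) : (T j : ℂ[T;T⁻¹]).coeff k = if j = k then 1 else 0 := T_apply k j

/-- The Laurent polynomial which is `α cos (j θ) + β sin (j θ)` on the unit circle. -/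
noncomputable def trigL (α β : ℝ) (j : ℤ) : ℂ[T;T⁻¹] :=
  C (α : ℂ) * cosMulL j + C (β : ℂ) * sinMulL j

theorem coeff_trigL (α β : ℝ) (j k : ℤ) : (trigL α β j).coeff k =
    (if j = k then (α - β * Complex.I) / 2 else 0) +
      (if -j = k then (α + β * Complex.I) / 2 else 0) := by
  simp only [trigL, cosMulL, sinMulL, AddMonoidAlgebra.coeff_add, AddMonoidAlgebra.coeff_sub,
    Finsupp.add_apply, Finsupp.sub_apply, coeff_C_mul, coeff_T]
  split_ifs <;> ring

theorem coeff_trigL_eq_zero (α β : ℝ) {j k : ℤ} (h1 : j ≠ k) (h2 : -j ≠ k) :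
    (trigL α β j).coeff k = 0 := by
  rw [coeff_trigL, if_neg h1, if_neg h2, add_zero]

theorem coeff_neg_trigL (α β : ℝ) (j k : ℤ) :
    (trigL α β j).coeff (-k) = starRingEnd ℂ ((trigL α β j).coeff k) := by
  have e1 : (j = -k) ↔ (-j = k) := by omega
  rw [coeff_trigL, coeff_trigL, map_add, apply_ite (starRingEnd ℂ), apply_ite (starRingEnd ℂ),
    map_zero]
  simp only [e1, neg_inj, map_div₀, map_sub, map_add, map_mul, Complex.conj_ofReal, Complex.conj_I,
    map_ofNat]
  rw [add_comm]
  congr 1 <;> congr 1 <;> ring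

theorem evalAngle_trigL (α β : ℝ) (j : ℤ) (θ : ℝ) :
    evalAngle θ (trigL α β j) = (α * Real.cos (j * θ) + β * Real.sin (j * θ) : ℝ) := by
  rw [trigL, map_add, map_mul, map_mul, evalAngle_C, evalAngle_C, evalAngle_cosMulL,
    evalAngle_sinMulL]
  push_cast
  rfl

/-- The Laurent polynomial which is `rotorPolynomial n ρ m a b` on the unit circle. -/
noncomputable def rotorL (n : ℕ) (ρ : ℝ) (m : ℕ) (a b : ℤ → ℝ) : ℂ[T;T⁻¹] :=
  C (ρ : ℂ) + ∑ k ∈ Finset.range (m + 1),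
    (trigL (a ((k : ℤ) * n + 1)) (b ((k : ℤ) * n + 1)) ((k : ℤ) * n + 1)
      + trigL (a ((k : ℤ) * n - 1)) (b ((k : ℤ) * n - 1)) ((k : ℤ) * n - 1))

variable (n : ℕ) (ρ : ℝ) (m : ℕ) (a b : ℤ → ℝ)

theorem evalAngle_rotorL (θ : ℝ) :
    evalAngle θ (rotorL n ρ m a b) = rotorPolynomial n ρ m a b θ := by
  rw [rotorL, rotorPolynomial, map_add, map_sum, evalAngle_C, Complex.ofReal_add,
    Complex.ofReal_sum]
  congr 1
  refine Finset.sum_congr rfl fun k _ => ?_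
  rw [map_add, evalAngle_trigL, evalAngle_trigL]
  push_cast
  ring

theorem coeff_rotorL (k : ℤ) : (rotorL n ρ m a b).coeff k =
    (if k = 0 then (ρ : ℂ) else 0) + ∑ i ∈ Finset.range (m + 1),
    ((trigL (a ((i : ℤ) * n + 1)) (b ((i : ℤ) * n + 1)) ((i : ℤ) * n + 1)).coeff k
      + (trigL (a ((i : ℤ) * n - 1)) (b ((i : ℤ) * n - 1)) ((i : ℤ) * n - 1)).coeff k) := by
  simp only [rotorL, AddMonoidAlgebra.coeff_add, AddMonoidAlgebra.coeff_sum, Finsupp.add_apply,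
    Finsupp.finsetSum_apply, C_apply]

theorem coeff_neg_rotorL (k : ℤ) :
    (rotorL n ρ m a b).coeff (-k) = starRingEnd ℂ ((rotorL n ρ m a b).coeff k) := by
  rw [coeff_rotorL, coeff_rotorL, map_add, map_sum, apply_ite (starRingEnd ℂ), map_zero,
    Complex.conj_ofReal]
  simp only [neg_eq_zero, map_add, coeff_neg_trigL]

theorem coeff_rotorL_of_not_dvd {k : ℤ} (h1 : ¬ (n : ℤ) ∣ k - 1) (h2 : ¬ (n : ℤ) ∣ k + 1) :
    (rotorL n ρ m a b).coeff k = if k = 0 then (ρ : ℂ) else 0 := by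
  rw [coeff_rotorL, Finset.sum_eq_zero, add_zero]
  intro i _
  rw [coeff_trigL_eq_zero, coeff_trigL_eq_zero, add_zero]
  · rintro rfl; exact h2 ⟨i, by ring⟩
  · rintro rfl; exact h1 ⟨-i, by ring⟩
  · rintro rfl; exact h1 ⟨i, by ring⟩
  · rintro rfl; exact h2 ⟨-i, by ring⟩

theorem coeff_zero_rotorL (hn : 3 ≤ n) : (rotorL n ρ m a b).coeff 0 = ρ := by
  rw [coeff_rotorL_of_not_dvd, if_pos rfl]
  · intro h
    have := Int.le_of_dvd one_pos (by simpa using h)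
    omega
  · intro h
    have := Int.le_of_dvd one_pos (by simpa using h)
    omega

/-- `N` is the largest absolute value of an exponent of `P`; conjugation symmetry makes both
coefficients at `±N` nonzero. -/
theorem rotorL_isPlaneCircle_or (hn : 3 ≤ n) (hρ : 0 < ρ) :
    IsPlaneCircle (supportCurve (rotorPolynomial n ρ m a b)) ∨ ∃ N : ℕ, n ≤ N + 1 ∧
      (∀ k : ℤ, (N : ℤ) < |k| → (rotorL n ρ m a b).coeff k = 0) ∧
      (rotorL n ρ m a b).coeff N ≠ 0 ∧ (rotorL n ρ m a b).coeff (-N) ≠ 0 := by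
  set P := rotorL n ρ m a b with hP
  have h0 : P.coeff 0 = ρ := coeff_zero_rotorL n ρ m a b hn
  have hconj : ∀ k, P.coeff (-k) = starRingEnd ℂ (P.coeff k) := coeff_neg_rotorL n ρ m a b
  have hne : (P.coeff.support.image Int.natAbs).Nonempty :=
    ⟨0, Finset.mem_image.2 ⟨0, by simp [h0, hρ.ne'], rfl⟩⟩
  obtain ⟨k, hk, hkN⟩ := Finset.mem_image.1 (Finset.max'_mem _ hne)
  set N := (P.coeff.support.image Int.natAbs).max' hne with hN
  have hPN : ∀ k : ℤ, (N : ℤ) < |k| → P.coeff k = 0 := by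
    intro j hj
    by_contra hj0
    rw [Int.abs_eq_natAbs] at hj
    have := Finset.le_max' (P.coeff.support.image Int.natAbs) j.natAbs
      (Finset.mem_image_of_mem _ (Finsupp.mem_support_iff.2 hj0))
    omega
  rw [Finsupp.mem_support_iff] at hk
  have hk' : P.coeff (-k) ≠ 0 := by
    rw [hconj]
    exact (map_ne_zero _).2 hk
  by_cases hN2 : N ≤ 1
  · left
    refine isPlaneCircle_supportCurve (evalAngle_rotorL n ρ m a b) hρ h0 (fun j hj => hPN j ?_)
      (hconj 1)
    omega
  · right
    refine ⟨N, ?_, hPN, ?_, ?_⟩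
    -- For `2 ≤ |k|` and `|k| + 1 < n`, the numbers `k ± 1` are nonzero and smaller than `n` in
    -- absolute value, so `n` divides neither.
    · by_contra hlt
      refine hk ?_
      rw [hP, coeff_rotorL_of_not_dvd, if_neg (by omega)]
      · intro h
        have := Int.le_of_dvd (by rw [abs_pos]; omega) ((dvd_abs _ _).2 h)
        rw [Int.abs_eq_natAbs] at this
        omega
      · intro h
        have := Int.le_of_dvd (by rw [abs_pos]; omega) ((dvd_abs _ _).2 h)
        rw [Int.abs_eq_natAbs] at this
        omega
    · rcases Int.natAbs_eq k with h | h <;> rw [hkN] at h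
      · rwa [← h]
      · rwa [h, neg_neg] at hk'
    · rcases Int.natAbs_eq k with h | h <;> rw [hkN] at h
      · rwa [h] at hk'
      · rwa [← h]

/-- The coefficients with the single nonzero value `ρ / n ^ 2` at `n - 1`. -/
noncomputable def singleCoeff (n : ℕ) (ρ : ℝ) (j : ℤ) : ℝ := if j = n - 1 then ρ / n ^ 2 else 0

theorem rotorL_singleCoeff (hn : 3 ≤ n) : rotorL n ρ 1 (singleCoeff n ρ) 0 =
    C (ρ : ℂ) + trigL (ρ / n ^ 2) 0 (n - 1) := by
  have h0 : ∀ j, trigL 0 0 j = 0 := by intro j; simp [trigL]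
  have e1 : singleCoeff n ρ 1 = 0 := if_neg (by omega)
  have e2 : singleCoeff n ρ (-1) = 0 := if_neg (by omega)
  have e3 : singleCoeff n ρ (n + 1) = 0 := if_neg (by omega)
  have e4 : singleCoeff n ρ (n - 1) = ρ / n ^ 2 := if_pos rfl
  simp [rotorL, Finset.sum_range_succ, e1, e2, e3, e4, h0]

theorem rotorPolynomial_singleCoeff (hn : 3 ≤ n) : rotorPolynomial n ρ 1 (singleCoeff n ρ) 0 =
    fun θ => ρ + ρ / n ^ 2 * Real.cos ((n - 1) * θ) := by
  ext θ
  have h := evalAngle_rotorL n ρ 1 (singleCoeff n ρ) 0 θ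
  rw [rotorL_singleCoeff n ρ hn, map_add, evalAngle_C, evalAngle_trigL] at h
  push_cast at h
  rw [zero_mul, add_zero] at h
  exact_mod_cast h.symm

/-- Here `p + p'' = ρ - ε ((n - 1)² - 1) cos ((n - 1)θ)` with `ε = ρ / n²`, and `(n - 1)² - 1 ≤ n²`.
-/
theorem singleCoeff_convex (hn : 3 ≤ n) (hρ : 0 < ρ) (θ : ℝ) :
    0 ≤ rotorPolynomial n ρ 1 (singleCoeff n ρ) 0 θ +
      deriv (deriv (rotorPolynomial n ρ 1 (singleCoeff n ρ) 0)) θ := by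
  rw [rotorPolynomial_singleCoeff n ρ hn]
  set ε := ρ / (n : ℝ) ^ 2 with hε
  set c : ℝ := n - 1 with hc
  have hlin : ∀ t : ℝ, HasDerivAt (fun t : ℝ => c * t) c t := fun t => by
    simpa using (hasDerivAt_id t).const_mul c
  have h1 : deriv (fun t : ℝ => ρ + ε * Real.cos (c * t)) =
      fun t => ε * (-Real.sin (c * t) * c) := by
    ext t
    exact (((hlin t).cos.const_mul ε).const_add ρ).deriv
  have h2 : deriv (fun t : ℝ => ε * (-Real.sin (c * t) * c)) θ =
      ε * (-(Real.cos (c * θ) * c) * c) :=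
    (((hlin θ).sin.neg.mul_const c).const_mul ε).deriv
  rw [h1, h2]
  have hn' : (3 : ℝ) ≤ n := by exact_mod_cast hn
  have hcos := Real.cos_le_one (c * θ)
  have hεn : ε * n ^ 2 = ρ := by rw [hε]; field_simp
  have hεpos : 0 < ε := by positivity
  have hk : 0 ≤ c ^ 2 - 1 := by rw [hc]; nlinarith
  have h3 : ε * ((c ^ 2 - 1) * Real.cos (c * θ)) ≤ ε * n ^ 2 := by
    refine mul_le_mul_of_nonneg_left ?_ hεpos.le
    refine (mul_le_of_le_one_right hk hcos).trans ?_
    rw [hc]; nlinarith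
  dsimp only
  linarith

end LaurentPolynomial

/-! ### The minimal degree -/

theorem mainTheorem5 (n : ℕ) (hn : 3 ≤ n) (ρ : ℝ) (hρ : 0 < ρ) :
    (∀ C : Set (Fin 2 → ℝ), IsAlgebraicRotor n ρ C → ¬ IsPlaneCircle C →
      ∃ f : MvPolynomial (Fin 2) ℝ, IsDefiningPolynomial C f) ∧
    IsLeast {d : ℕ | ∃ (C : Set (Fin 2 → ℝ)) (f : MvPolynomial (Fin 2) ℝ),
      IsAlgebraicRotor n ρ C ∧ ¬ IsPlaneCircle C ∧ IsDefiningPolynomial C f ∧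
      f.totalDegree = d} (2 * n) := by
  have hP0 : ∀ m a b, (rotorL n ρ m a b).coeff 0 ≠ 0 := by
    intro m a b
    rw [coeff_zero_rotorL n ρ m a b hn]
    exact_mod_cast hρ.ne'
  refine ⟨?_, ?_, ?_⟩
  · rintro _ ⟨m, a, b, -, rfl⟩ hcirc
    obtain ⟨N, hN, hPN, h1, h2⟩ :=
      (rotorL_isPlaneCircle_or n ρ m a b hn hρ).resolve_left hcirc
    exact exists_isDefiningPolynomial (evalAngle_rotorL n ρ m a b) (by omega) hPN h1 h2
  · have hP := rotorL_singleCoeff n ρ hn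
    have hp := evalAngle_rotorL n ρ 1 (singleCoeff n ρ) 0
    have h0 := hP0 1 (singleCoeff n ρ) 0
    have hcast : ((n - 1 : ℕ) : ℤ) = n - 1 := by omega
    have hN : 2 ≤ n - 1 := by omega
    have hcoeff : ∀ k : ℤ, k ≠ 0 → (rotorL n ρ 1 (singleCoeff n ρ) 0).coeff k =
        (trigL (ρ / n ^ 2) 0 (n - 1)).coeff k := by
      intro k hk
      rw [hP, AddMonoidAlgebra.coeff_add, Finsupp.add_apply, LaurentPolynomial.C_apply, if_neg hk,
        zero_add]
    have hPN : ∀ k : ℤ, ((n - 1 : ℕ) : ℤ) < |k| →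
        (rotorL n ρ 1 (singleCoeff n ρ) 0).coeff k = 0 := by
      intro k hk
      rw [hcoeff k (by rintro rfl; simp at hk; omega)]
      rw [lt_abs] at hk
      exact coeff_trigL_eq_zero _ _ (by omega) (by omega)
    have h1 : (rotorL n ρ 1 (singleCoeff n ρ) 0).coeff (n - 1 : ℕ) ≠ 0 := by
      rw [hcoeff _ (by omega), coeff_trigL, if_pos hcast.symm, if_neg (by omega)]
      have : n ≠ 0 := by omega
      simp [hρ.ne', this]
    have h2 : (rotorL n ρ 1 (singleCoeff n ρ) 0).coeff (-(n - 1 : ℕ)) ≠ 0 := by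
      rw [coeff_neg_rotorL]
      exact (map_ne_zero _).2 h1
    obtain ⟨f, hf⟩ := exists_isDefiningPolynomial hp hN hPN h1 h2
    refine ⟨_, f, ⟨1, singleCoeff n ρ, 0, singleCoeff_convex n ρ hn hρ, rfl⟩,
      not_isPlaneCircle_supportCurve hp h0 hN hPN h1 h2, hf, le_antisymm ?_ ?_⟩
    -- The defining polynomial divides the relation of degree at most `2 * (N + 1) = 2n`, where `N =
    -- n - 1`.
    · obtain ⟨g, hg, hgd, hg0⟩ := exists_supportCurve_relation hp hN hPN h1 h2
      have := MvPolynomial.totalDegree_le_of_dvd_of_isDomain ((hf.2 g).1 hg0) hg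
      omega
    · have := le_totalDegree_of_supportCurve hp h0 hN hPN h1 h2 hf.1.ne_zero
        ((hf.2 f).2 dvd_rfl)
      omega
  · rintro _ ⟨_, f, ⟨m, a, b, -, rfl⟩, hcirc, hf, rfl⟩
    obtain ⟨N, hN, hPN, h1, h2⟩ :=
      (rotorL_isPlaneCircle_or n ρ m a b hn hρ).resolve_left hcirc
    have := le_totalDegree_of_supportCurve (evalAngle_rotorL n ρ m a b) (hP0 m a b) (by omega)
      hPN h1 h2 hf.1.ne_zero ((hf.2 f).2 dvd_rfl)
    omega
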